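/- For real $\lambda>0$ and $B$ consider the system $$x'=y,\qquad y'=-\lambda^2x+\frac{\lambda-1}{\lambda}\,B\,x^{\frac{\lambda-2}{\lambda}},\qquad P=-\frac{y^2}{2}-\frac{\lambda^2}{2}x^2+\frac B2|x|^{\frac{2\lambda-2}{\lambda}},$$ where $P$ is its conserved Hamiltonian, and where, here and below, $x^{a}$ means $\operatorname{sgn}(x)|x|^{a}$ when $x<0$. A solution defined for all $\theta\in\mathbb R$ is called elliptic if $x$ never vanishes. Then the following hold. (1) Let $1<\lambda<2$, $B>0$, and let $P_{\max}=\frac{B}{2\lambda}\left(\frac{(\lambda-1)B}{\lambda^3}\right)^{\lambda-1}$ be the value of $P$ at the equilibria with $x\neq0$. For every $0<P<P_{\max}$ there are elliptic solutions on the level $P$, and all of them are periodic with the same least positive period $T(P)$, which satisfies $$\pi<T(P)<\frac{2\pi}{\sqrt{2\lambda}}.$$ Moreover $T(P)\to\pi$ as $P\to0^+$ and $T(P)\to\frac{2\pi}{\sqrt{2\lambda}}$ as $P\to P_{\max}^-$. (2) If $1<\lambda<2$ (in particular if $1<\lambda<4/3$), then for every $B\in\mathbb R$ the system has no nonconstant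 $2\pi$-periodic elliptic solution. (3) For every $\lambda>0$, all $B,P\in\mathbb R$ and every function $x:\mathbb R\to\mathbb R$: $x$ is (the first component of) an elliptic solution of the system with parameters $(\lambda,B)$ on the level $P$ if and only if $\theta\mapsto x(\theta/\lambda)^{1/\lambda}$ is (the first component of) an elliptic solution of the system with parameters $\left(\frac1\lambda,-\frac{2P}{\lambda^4}\right)$ on the level $-\frac{B}{2\lambda^4}$. (4) If $3/4<\lambda<1$, then for every $B\in\mathbb R$ the system has no nonconstant $2\pi$-periodic elliptic solution. -/

import Mathlib

open Filter Topology

noncomputable section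

/-- The odd real power `sgn(x) |x|^a`. For `x > 0` it is the ordinary power `x ^ a`. -/
def signedPow (x a : ℝ) : ℝ := Real.sign x * |x| ^ a

theorem signedPow_of_pos {x : ℝ} (hx : 0 < x) (a : ℝ) : signedPow x a = x ^ a := by
  simp [signedPow, Real.sign_of_pos hx, abs_of_pos hx]

theorem signedPow_neg (x a : ℝ) : signedPow (-x) a = -signedPow x a := by
  simp [signedPow, Real.sign_neg]

/-- A global elliptic solution `(x, y)` of the system
`x' = y`, `y' = -λ² x + ((λ - 1) / λ) B x ^ ((λ - 2) / λ)`: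
a solution on the whole line whose stream-function component `x` never vanishes.
(For `x < 0` the power is the odd one, so `x ↦ -x` is a symmetry of the system.) -/
structure IsEllipticSolution (lam B : ℝ) (x y : ℝ → ℝ) : Prop where
  ne_zero : ∀ θ, x θ ≠ 0
  hasDerivAt_fst : ∀ θ, HasDerivAt x (y θ) θ
  hasDerivAt_snd : ∀ θ, HasDerivAt y
    (-lam ^ 2 * x θ + (lam - 1) / lam * B * signedPow (x θ) ((lam - 2) / lam)) θ

/-- The Hamiltonian (pressure)
`P = -y²/2 - (λ²/2) x² + (B/2) |x| ^ ((2λ - 2)/λ)` of the system. -/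
def pressure (lam B x y : ℝ) : ℝ :=
  -(y ^ 2 / 2) - lam ^ 2 / 2 * x ^ 2 + B / 2 * |x| ^ ((2 * lam - 2) / lam)

/-- `x` is (the first component of) an elliptic solution on the energy level `P`. -/
def IsEllipticAtLevel (lam B P : ℝ) (x : ℝ → ℝ) : Prop :=
  ∃ y : ℝ → ℝ, IsEllipticSolution lam B x y ∧ ∀ θ, pressure lam B (x θ) (y θ) = P

/-- For `λ > 1`, `B > 0`: the pressure of the nonzero equilibria ("pure rotations"), which is the
largest pressure in the elliptic region. -/
def maxPressure (lam B : ℝ) : ℝ :=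
  B / (2 * lam) * ((lam - 1) * B / lam ^ 3) ^ (lam - 1)

/-- The period function: the least positive period of the elliptic solutions on the level `P`. -/
def periodFunction (lam B P : ℝ) : ℝ :=
  sInf {T : ℝ | 0 < T ∧ ∃ x : ℝ → ℝ, IsEllipticAtLevel lam B P x ∧ Function.Periodic x T}

/-- The conjugacy `x ↦ x^{1/λ}(θ/λ)` (with the odd power). -/
def conjugate (lam : ℝ) (x : ℝ → ℝ) : ℝ → ℝ := fun θ => signedPow (x (θ / lam)) (1 / lam)

end

/-!
On a fixed level `P` a positive solution satisfies `y² = F x` with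
`F x = B x ^ (2 - 2/λ) - λ² x² - 2P` (`speedSq`). For `1 < λ < 2`, `B > 0` and
`0 < P < maxPressure`, this function has exactly two positive zeros `a < b`, both simple, and `x`
swings between them.

*Existence and periodicity.* With `F = (x - a)(b - x) g` and `x = a + (b - a)(1 - cos φ)/2` the
motion becomes `φ' = √(g x)`, solved by inverting an integral (`exists_isOscillation`). The force is
Lipschitz on `[a, b]`, so every elliptic solution on the level is, up to sign, a time shift of this
one (`IsOscillation.exists_eq_shift`). Hence the period function is twice the passage time `τ` from
`a` to `b`.

*Bounds.* In a coordinate `z = x ^ α` one has `z'² = H z`, where `H` is a combination of three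
powers. If `H z - κ (z - z₁)(z₂ - z)` has a constant sign between the turning points `z₁ < z₂`,
the mean value theorem for the angle of a harmonic oscillator (`exists_speed_sq_eq`) compares
`(π/τ)²` with `κ`. The sign follows from the second derivative, which in terms of `x` is a
three-term function `R_α = -H''/2` (`coordFreqSq`). Four choices of `α` give everything:

* `α = 2/λ`: `R_α < 4`, so the period exceeds `π`;
* `α = 2(1 + 1/λ)/3`: `R_α - 2λ` is a positive multiple of `F x / x²`, so the period is less than
  `2π/√(2λ)`;
* `α = 1`: `R_α` does not depend on `P` and is close to `2λ` near the equilibrium, which gives the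
  limit at the maximal pressure;
* `α` slightly below `2/λ`: for small `P` the period is at most `2π/√κ` for any `κ < λ² α²`, a bound
  arbitrarily close to `4`, which gives the limit as `P → 0`.

*Nonexistence.* A nonconstant periodic solution forces `B > 0` and `0 < P < maxPressure`
(`IsPositiveSolution.level_mem`), and no multiple of a number in `(π, 2π/√(2λ))` lies in
`[2π/√(2λ), 2π]`. For `λ < 1` the same statement is applied to the conjugate solution, whose
parameter is `1/λ`.
-/

noncomputable section

/-! ### Oscillations between two simple turning points -/

/-- A solution `(X, Y)` of `X' = Y`, `Y' = f X` on the energy curve `Y² = F X` which swings between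
the turning points `a` (at time `0`) and `b` (at time `τ`). It has least period `2τ` and runs
through the whole energy curve over `[a, b]`. -/
structure IsOscillation (F f : ℝ → ℝ) (a b τ : ℝ) (X Y : ℝ → ℝ) : Prop where
  half_pos : 0 < τ
  hasDerivAt_fst : ∀ t, HasDerivAt X (Y t) t
  hasDerivAt_snd : ∀ t, HasDerivAt Y (f (X t)) t
  energy : ∀ t, Y t ^ 2 = F (X t)
  mem_Icc : ∀ t, X t ∈ Set.Icc a b
  map_zero : X 0 = a
  map_half : X τ = b
  rising : ∀ t ∈ Set.Ioo 0 τ, 0 < Y t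
  periodic : Function.Periodic X (2 * τ)
  return_le : ∀ S, 0 < S → X S = a → 2 * τ ≤ S
  exists_eq : ∀ p q, p ∈ Set.Icc a b → q ^ 2 = F p → ∃ t, X t = p ∧ Y t = q

theorem exists_factor_of_simple_zeros {F f : ℝ → ℝ} {a b : ℝ} (hab : a < b)
    (hF : ∀ x ∈ Set.Icc a b, HasDerivAt F (2 * f x) x) (ha : F a = 0) (hb : F b = 0)
    (hpos : ∀ x ∈ Set.Ioo a b, 0 < F x) (hfa : 0 < f a) (hfb : f b < 0) :
    ∃ g : ℝ → ℝ, ContinuousOn g (Set.Icc a b) ∧ (∀ x ∈ Set.Icc a b, 0 < g x) ∧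
      ∀ x, F x = (x - a) * (b - x) * g x := by
  have haI : a ∈ Set.Icc a b := ⟨le_rfl, hab.le⟩
  have hbI : b ∈ Set.Icc a b := ⟨hab.le, le_rfl⟩
  set h := dslope F a with hh
  have h1 : ∀ x, F x = (x - a) * h x := fun x => by
    have := sub_smul_dslope F a x
    simp only [smul_eq_mul, ha, sub_zero] at this
    exact this.symm
  have hhb : h b = 0 := by
    have := h1 b
    rw [hb] at this
    rcases mul_eq_zero.1 this.symm with h0 | h0
    · linarith
    · exact h0
  have h2 : ∀ x, h x = (x - b) * dslope h b x := fun x => by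
    have := sub_smul_dslope h b x
    simp only [smul_eq_mul, hhb, sub_zero] at this
    exact this.symm
  have hc1 : ∀ x ∈ Set.Icc a b, ContinuousAt h x := fun x hx => by
    rcases eq_or_ne x a with rfl | hne
    · exact continuousAt_dslope_same.2 (hF x hx).differentiableAt
    · exact (continuousAt_dslope_of_ne hne).2 (hF x hx).continuousAt
  have hdb : DifferentiableAt ℝ h b :=
    (differentiableAt_dslope_of_ne hab.ne').2 (hF b hbI).differentiableAt
  have hc2 : ∀ x ∈ Set.Icc a b, ContinuousAt (dslope h b) x := fun x hx => by
    rcases eq_or_ne x b with rfl | hne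
    · exact continuousAt_dslope_same.2 hdb
    · exact (continuousAt_dslope_of_ne hne).2 (hc1 x hx)
  have hfac : ∀ x, F x = (x - a) * (b - x) * (-dslope h b x) := fun x => by
    rw [h1 x, h2 x]; ring
  refine ⟨fun x => -dslope h b x, fun x hx => (hc2 x hx).neg.continuousWithinAt, ?_, hfac⟩
  intro x hx
  have hba : 0 < b - a := sub_pos.2 hab
  rcases eq_or_ne x a with rfl | hxa
  · have e1 : h x = 2 * f x := by rw [hh, dslope_same, (hF x haI).deriv]
    have e2 := h2 x
    by_contra hcon
    simp only [not_lt] at hcon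
    nlinarith
  rcases eq_or_ne x b with rfl | hxb
  · -- at the right end point the second slope is `h' b = F' b / (b - a)`
    have e1 : dslope h x x = deriv h x := dslope_same _ _
    have e2 : HasDerivAt F (1 * h x + (x - a) * deriv h x) x := by
      have := ((hasDerivAt_id x).sub_const a).mul hdb.hasDerivAt
      exact this.congr_of_eventuallyEq (Eventually.of_forall h1)
    have e3 := e2.unique (hF x hbI)
    rw [hhb] at e3
    simp only [e1]
    by_contra hcon
    simp only [not_lt] at hcon
    nlinarith
  · have hx' : x ∈ Set.Ioo a b := ⟨lt_of_le_of_ne hx.1 (Ne.symm hxa), lt_of_le_of_ne hx.2 hxb⟩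
    have hp := hpos x hx'
    rw [hfac x] at hp
    exact (mul_pos_iff_of_pos_left
      (mul_pos (sub_pos.2 hx'.1) (sub_pos.2 hx'.2))).1 hp

/-- The solution is parametrised by the angle `φ` with `X = a + (b - a)(1 - cos φ)/2`. If
`F = (x - a)(b - x) g` then `φ' = √(g X)`, so time is an explicit integral of a positive periodic
function of `φ`, and `φ` is the inverse function. -/
theorem exists_isOscillation {F f : ℝ → ℝ} {a b : ℝ} (hab : a < b)
    (hF : ∀ x ∈ Set.Icc a b, HasDerivAt F (2 * f x) x) (hf : ContinuousOn f (Set.Icc a b))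
    (ha : F a = 0) (hb : F b = 0)
    (hpos : ∀ x ∈ Set.Ioo a b, 0 < F x) (hfa : 0 < f a) (hfb : f b < 0) :
    ∃ (τ : ℝ) (X Y : ℝ → ℝ), IsOscillation F f a b τ X Y := by
  obtain ⟨g, hgc, hgp, hfac⟩ := exists_factor_of_simple_zeros hab hF ha hb hpos hfa hfb
  have hba : 0 < b - a := sub_pos.2 hab
  set r := (b - a) / 2 with hr
  have hr0 : 0 < r := by positivity
  set p : ℝ → ℝ := fun φ => a + r * (1 - Real.cos φ) with hp
  have hpI : ∀ φ, p φ ∈ Set.Icc a b := fun φ => by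
    have h1 := Real.cos_le_one φ
    have h2 := Real.neg_one_le_cos φ
    constructor <;> simp only [hp, hr] <;> nlinarith
  have hpc : Continuous p := by fun_prop
  have hgpc : Continuous fun φ => g (p φ) := hgc.comp_continuous hpc hpI
  set ρ : ℝ → ℝ := fun φ => (√(g (p φ)))⁻¹ with hρ
  have hsq : ∀ φ, 0 < √(g (p φ)) := fun φ => Real.sqrt_pos.2 (hgp _ (hpI φ))
  have hρ0 : ∀ φ, 0 < ρ φ := fun φ => inv_pos.2 (hsq φ)
  have hρc : Continuous ρ := (hgpc.sqrt).inv₀ fun φ => (hsq φ).ne'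
  have hρi : ∀ u v, IntervalIntegrable ρ MeasureTheory.volume u v := fun u v =>
    hρc.intervalIntegrable u v
  have hρper : Function.Periodic ρ (2 * Real.pi) := fun φ => by simp [hρ, hp]
  set Θ : ℝ → ℝ := fun φ => ∫ s in (0 : ℝ)..φ, ρ s with hΘ
  have hΘd : ∀ φ, HasDerivAt Θ (ρ φ) φ := fun φ =>
    intervalIntegral.integral_hasDerivAt_right (hρi _ _)
      (hρc.stronglyMeasurableAtFilter _ _) hρc.continuousAt
  have hΘm : StrictMono Θ := strictMono_of_hasDerivAt_pos hΘd hρ0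
  have hΘ0 : Θ 0 = 0 := by simp [hΘ]
  have hpi := Real.pi_pos
  have h2pi : 0 < 2 * Real.pi := by positivity
  have hΘs : Function.Surjective Θ := by
    refine Continuous.surjective
      (continuous_iff_continuousAt.2 fun φ => (hΘd φ).continuousAt) ?_ ?_
    · exact hρper.tendsto_atTop_intervalIntegral_of_pos' (hρi _ _) hρ0 h2pi
    · exact hρper.tendsto_atBot_intervalIntegral_of_pos' (hρi _ _) hρ0 h2pi
  have hΘadd : ∀ φ, Θ (φ + 2 * Real.pi) = Θ φ + Θ (2 * Real.pi) := fun φ => by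
    have := hρper.intervalIntegral_add_eq_add 0 φ hρi
    simpa [hΘ] using this
  set τ := Θ Real.pi with hτ
  have hτ0 : 0 < τ := by
    have := hΘm hpi
    rwa [hΘ0] at this
  have hΘ2 : Θ (2 * Real.pi) = 2 * τ := by
    have h1 : Θ (2 * Real.pi) = τ + ∫ s in Real.pi..(2 * Real.pi), ρ s :=
      (intervalIntegral.integral_add_adjacent_intervals (hρi _ _) (hρi _ _)).symm
    have h2 : ∫ s in Real.pi..(2 * Real.pi), ρ s = τ := by
      have h3 : ∀ s, ρ (2 * Real.pi - s) = ρ s := fun s => by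
        simp [hρ, hp, Real.cos_two_pi_sub]
      have h4 := intervalIntegral.integral_comp_sub_left (a := 0) (b := Real.pi) ρ (2 * Real.pi)
      simp only [h3] at h4
      rw [hτ, hΘ]
      simp only
      rw [h4]
      congr 1 <;> ring
    rw [h1, h2]; ring
  set e := hΘm.orderIsoOfSurjective Θ hΘs with he
  set Φ : ℝ → ℝ := fun t => e.symm t with hΦ
  have hΦΘ : ∀ φ, Φ (Θ φ) = φ := fun φ => StrictMono.orderIsoOfSurjective_symm_apply_self Θ hΘm hΘs φ
  have hΘΦ : ∀ t, Θ (Φ t) = t := fun t => StrictMono.orderIsoOfSurjective_self_symm_apply Θ hΘm hΘs t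
  have hΦm : StrictMono Φ := e.symm.strictMono
  have hΦc : Continuous Φ := e.symm.continuous
  have hΦd : ∀ t, HasDerivAt Φ (√(g (p (Φ t)))) t := fun t => by
    have := HasDerivAt.of_local_left_inverse hΦc.continuousAt (hΘd (Φ t)) (hρ0 _).ne'
      (Eventually.of_forall hΘΦ)
    simpa [hρ] using this
  have hΦ0 : Φ 0 = 0 := by simpa only [hΘ0] using hΦΘ 0
  have hΦτ : Φ τ = Real.pi := hΦΘ _
  have hΦadd : ∀ t, Φ (t + 2 * τ) = Φ t + 2 * Real.pi := fun t => by
    rw [← hΦΘ (Φ t + 2 * Real.pi), hΘadd, hΘΦ, hΘ2]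
  set X : ℝ → ℝ := fun t => p (Φ t) with hX
  set Y : ℝ → ℝ := fun t => r * Real.sin (Φ t) * √(g (X t)) with hY
  have hXI : ∀ t, X t ∈ Set.Icc a b := fun t => hpI _
  have hXd : ∀ t, HasDerivAt X (Y t) t := fun t => by
    have h1 : HasDerivAt p (r * Real.sin (Φ t)) (Φ t) := by
      have := (((Real.hasDerivAt_cos (Φ t)).const_sub 1).const_mul r).const_add a
      exact this.congr_deriv (by ring)
    exact h1.comp t (hΦd t)
  have hXc : Continuous X := hpc.comp hΦc
  have hYc : Continuous Y :=
    ((continuous_const.mul (Real.continuous_sin.comp hΦc))).mul (hgpc.comp hΦc).sqrt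
  have hE : ∀ t, Y t ^ 2 = F (X t) := fun t => by
    rw [hfac, hY]
    simp only
    rw [mul_pow, Real.sq_sqrt (hgp _ (hXI t)).le]
    congr 1
    have := Real.sin_sq_add_cos_sq (Φ t)
    simp only [hX, hp]
    have hb' : b = a + 2 * r := by rw [hr]; ring
    rw [hb']
    linear_combination r ^ 2 * this
  have hYd1 : ∀ t, Y t ≠ 0 → HasDerivAt Y (f (X t)) t := fun t ht => by
    have hFX : HasDerivAt (fun s => F (X s)) (2 * f (X t) * Y t) t :=
      (hF _ (hXI t)).comp t (hXd t)
    have hFne : F (X t) ≠ 0 := by rw [← hE]; positivity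
    have hs := hFX.sqrt hFne
    have hval : √(F (X t)) = |Y t| := by rw [← hE, Real.sqrt_sq_eq_abs]
    rw [hval] at hs
    rcases lt_or_gt_of_ne ht with hlt | hgt
    · have hs' := hs.neg
      rw [abs_of_neg hlt] at hs'
      refine (hs'.congr_of_eventuallyEq ?_).congr_deriv (by field_simp)
      filter_upwards [hYc.continuousAt.eventually (gt_mem_nhds hlt)] with s hs
      simp only [Pi.neg_apply]
      rw [← hE, Real.sqrt_sq_eq_abs, abs_of_neg hs, neg_neg]
    · rw [abs_of_pos hgt] at hs
      refine (hs.congr_of_eventuallyEq ?_).congr_deriv (by field_simp)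
      filter_upwards [hYc.continuousAt.eventually (lt_mem_nhds hgt)] with s hs
      rw [← hE, Real.sqrt_sq_eq_abs, abs_of_pos hs]
  -- the turning points are isolated, so the equation extends to them by continuity
  have hcount : {t : ℝ | Y t = 0}.Countable := by
    have hsub : {t : ℝ | Y t = 0} ⊆ Set.range fun n : ℤ => Θ (n * Real.pi) := fun t ht => by
      have h0 : Real.sin (Φ t) = 0 := by
        have h1 : r * Real.sin (Φ t) * √(g (X t)) = 0 := ht
        rcases mul_eq_zero.1 h1 with h2 | h2
        · exact (mul_eq_zero.1 h2).resolve_left hr0.ne'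
        · exact absurd h2 (hsq (Φ t)).ne'
      obtain ⟨n, hn⟩ := Real.sin_eq_zero_iff.1 h0
      exact ⟨n, by simp only [hn, hΘΦ]⟩
    exact (Set.countable_range _).mono hsub
  have hfX : Continuous fun t => f (X t) := hf.comp_continuous hXc hXI
  have hYint : ∀ t, Y t = Y 0 + ∫ s in (0 : ℝ)..t, f (X s) := fun t => by
    rw [MeasureTheory.integral_eq_of_hasDerivAt_off_countable Y (fun s => f (X s)) hcount
      hYc.continuousOn (fun s hs => hYd1 s hs.2) (hfX.intervalIntegrable _ _)]
    ring
  have hYd : ∀ t, HasDerivAt Y (f (X t)) t := fun t => by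
    have h1 : HasDerivAt (fun t => ∫ s in (0 : ℝ)..t, f (X s)) (f (X t)) t :=
      intervalIntegral.integral_hasDerivAt_right (hfX.intervalIntegrable _ _)
        (hfX.stronglyMeasurableAtFilter _ _) hfX.continuousAt
    exact (h1.const_add (Y 0)).congr_of_eventuallyEq (Eventually.of_forall hYint)
  refine ⟨τ, X, Y, hτ0, hXd, hYd, hE, hXI, ?_, ?_, ?_, ?_, ?_, ?_⟩
  · simp [hX, hp, hΦ0]
  · simp only [hX, hp, hΦτ, Real.cos_pi, hr]; ring
  · intro t ht
    have h1 : 0 < Φ t := by rw [← hΦ0]; exact hΦm ht.1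
    have h2 : Φ t < Real.pi := by rw [← hΦτ]; exact hΦm ht.2
    exact mul_pos (mul_pos hr0 (Real.sin_pos_of_pos_of_lt_pi h1 h2)) (hsq _)
  · intro t
    simp only [hX, hΦadd, hp, Real.cos_add_two_pi]
  · intro S hS hXS
    have h1 : Real.cos (Φ S) = 1 := by
      have h2 : r * (1 - Real.cos (Φ S)) = 0 := by
        have : a + r * (1 - Real.cos (Φ S)) = a := hXS
        linarith
      linarith [(mul_eq_zero.1 h2).resolve_left hr0.ne']
    obtain ⟨n, hn⟩ := (Real.cos_eq_one_iff _).1 h1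
    have h3 : 0 < Φ S := by rw [← hΦ0]; exact hΦm hS
    have h4 : (1 : ℝ) ≤ n := by
      rw [← hn] at h3
      have : (0 : ℝ) < n := by
        by_contra hcon
        nlinarith
      exact_mod_cast this
    have h5 : 2 * Real.pi ≤ Φ S := by rw [← hn]; nlinarith
    rw [← hΘ2, ← hΘΦ S]
    exact hΘm.monotone h5
  · intro q y hq hy
    set c := 1 - (q - a) / r with hc
    have hc1 : -1 ≤ c := by
      have : (q - a) / r ≤ 2 := by rw [div_le_iff₀ hr0, hr]; linarith [hq.2]
      linarith
    have hc2 : c ≤ 1 := by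
      have : 0 ≤ (q - a) / r := div_nonneg (by linarith [hq.1]) hr0.le
      linarith
    have hpq : ∀ φ, Real.cos φ = c → X (Θ φ) = q := fun φ hφ => by
      simp only [hX, hΦΘ, hp, hφ, hc]
      field_simp
      ring
    have hcos := Real.cos_arccos hc1 hc2
    have hX1 := hpq _ hcos
    have hX2 := hpq (-Real.arccos c) (by rw [Real.cos_neg, hcos])
    have hY2 : Y (Θ (-Real.arccos c)) = -Y (Θ (Real.arccos c)) := by
      simp only [hY, hX1, hX2, hΦΘ, Real.sin_neg]; ring
    have h1 : y ^ 2 = Y (Θ (Real.arccos c)) ^ 2 := by rw [hE, hX1, hy]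
    rcases sq_eq_sq_iff_eq_or_eq_neg.1 h1 with h2 | h2
    · exact ⟨_, hX1, h2.symm⟩
    · exact ⟨_, hX2, by rw [hY2, h2]⟩

theorem IsOscillation.continuous {F f X Y : ℝ → ℝ} {a b τ : ℝ} (h : IsOscillation F f a b τ X Y) :
    Continuous X :=
  continuous_iff_continuousAt.2 fun t => (h.hasDerivAt_fst t).continuousAt

/-- Every solution on the energy curve over `[a, b]` is a time shift of the oscillation. -/
theorem IsOscillation.exists_eq_shift {F f X Y : ℝ → ℝ} {a b τ : ℝ}
    (h : IsOscillation F f a b τ X Y) {K : NNReal} (hf : LipschitzOnWith K f (Set.Icc a b))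
    {x y : ℝ → ℝ} (hx : ∀ t, HasDerivAt x (y t) t) (hy : ∀ t, HasDerivAt y (f (x t)) t)
    (hE : ∀ t, y t ^ 2 = F (x t)) (hxI : ∀ t, x t ∈ Set.Icc a b) :
    ∃ t₀, ∀ t, x t = X (t + t₀) := by
  obtain ⟨t₀, h1, h2⟩ := h.exists_eq (x 0) (y 0) (hxI 0) (hE 0)
  refine ⟨t₀, ?_⟩
  let v : ℝ → ℝ × ℝ → ℝ × ℝ := fun _ q => (q.2, f q.1)
  have hv : ∀ t, LipschitzOnWith (max 1 K) (v t) (Set.Icc a b ×ˢ Set.univ) := fun t => by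
    refine LipschitzOnWith.prodMk (LipschitzWith.prod_snd.lipschitzOnWith) ?_
    have := hf.comp (LipschitzWith.prod_fst (α := ℝ) (β := ℝ)).lipschitzOnWith
      (s := Set.Icc a b ×ˢ Set.univ) (fun q hq => hq.1)
    rw [mul_one] at this
    exact this
  have key : (fun t => (x t, y t)) = fun t => (X (t + t₀), Y (t + t₀)) := by
    refine ODE_solution_unique_univ (v := v) (s := fun _ => Set.Icc a b ×ˢ Set.univ) (t₀ := 0)
      hv ?_ ?_ ?_
    · exact fun t => ⟨(hx t).prodMk (hy t), hxI t, trivial⟩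
    · exact fun t => ⟨((h.hasDerivAt_fst _).comp_add_const t t₀).prodMk
        ((h.hasDerivAt_snd _).comp_add_const t t₀), h.mem_Icc _, trivial⟩
    · simp [h1, h2]
  intro t
  exact congrArg Prod.fst (congrFun key t)

theorem IsOscillation.not_periodic {F f X Y : ℝ → ℝ} {a b τ S : ℝ}
    (h : IsOscillation F f a b τ X Y) (hS : 0 < S) (h1 : S ≠ 2 * τ) (h2 : S < 4 * τ) :
    ¬ Function.Periodic X S := by
  intro hper
  have ret : ∀ S', Function.Periodic X S' → 0 < S' → 2 * τ ≤ S' := fun S' hp h0 =>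
    h.return_le S' h0 (by rw [← h.map_zero, ← hp 0, zero_add])
  have h3 := ret S hper hS
  have h4 := ret (S - 2 * τ) (hper.sub_period h.periodic)
    (sub_pos.2 (lt_of_le_of_ne h3 (Ne.symm h1)))
  linarith

/-! ### Comparison of the half-period with that of a harmonic oscillator -/

/-- A monotone passage from `u` to `v` in time `τ` agrees at some instant with the speed of the
harmonic oscillator that needs the same time: the mean value theorem for the angle
`arcsin ((2z - u - v) / (v - u))`. -/
theorem exists_speed_sq_eq {z w : ℝ → ℝ} {u v τ : ℝ} (hτ : 0 < τ) (hz : Continuous z)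
    (hz0 : z 0 = u) (hzτ : z τ = v) (hd : ∀ t ∈ Set.Ioo 0 τ, HasDerivAt z (w t) t)
    (hI : ∀ t ∈ Set.Ioo 0 τ, z t ∈ Set.Ioo u v) :
    ∃ t ∈ Set.Ioo 0 τ, w t ^ 2 = (Real.pi / τ) ^ 2 * ((z t - u) * (v - z t)) := by
  have huv : u < v := by
    have := hI (τ / 2) ⟨by positivity, by linarith⟩
    exact this.1.trans this.2
  have hvu : 0 < v - u := sub_pos.2 huv
  set A : ℝ → ℝ := fun t => Real.arcsin ((2 * z t - u - v) / (v - u)) with hA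
  have hAc : Continuous A := Real.continuous_arcsin.comp (by fun_prop)
  have hrad : ∀ t ∈ Set.Ioo 0 τ, 1 - ((2 * z t - u - v) / (v - u)) ^ 2
      = 4 * ((z t - u) * (v - z t)) / (v - u) ^ 2 := fun t ht => by
    field_simp; ring
  have hprod : ∀ t ∈ Set.Ioo 0 τ, 0 < (z t - u) * (v - z t) := fun t ht =>
    mul_pos (sub_pos.2 (hI t ht).1) (sub_pos.2 (hI t ht).2)
  have hAd : ∀ t ∈ Set.Ioo 0 τ, HasDerivAt A
      (1 / √(1 - ((2 * z t - u - v) / (v - u)) ^ 2) * (2 * w t / (v - u))) t := fun t ht => by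
    have hlt : ((2 * z t - u - v) / (v - u)) ^ 2 < 1 := by
      have := hrad t ht
      have h2 : 0 < 4 * ((z t - u) * (v - z t)) / (v - u) ^ 2 := by
        have := hprod t ht
        positivity
      linarith
    have h1 : (2 * z t - u - v) / (v - u) ≠ -1 := fun h => by rw [h] at hlt; norm_num at hlt
    have h2 : (2 * z t - u - v) / (v - u) ≠ 1 := fun h => by rw [h] at hlt; norm_num at hlt
    have h3 : HasDerivAt (fun t => (2 * z t - u - v) / (v - u)) (2 * w t / (v - u)) t :=
      ((((hd t ht).const_mul 2).sub_const u).sub_const v).div_const _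
    exact (Real.hasDerivAt_arcsin h1 h2).comp t h3
  obtain ⟨t, ht, he⟩ := exists_hasDerivAt_eq_slope A _ hτ hAc.continuousOn hAd
  refine ⟨t, ht, ?_⟩
  have e0 : A 0 = -(Real.pi / 2) := by
    simp only [hA, hz0]
    rw [show (2 * u - u - v) / (v - u) = -1 by field_simp; ring, Real.arcsin_neg_one]
  have e1 : A τ = Real.pi / 2 := by
    simp only [hA, hzτ]
    rw [show (2 * v - u - v) / (v - u) = 1 by field_simp; ring, Real.arcsin_one]
  rw [e0, e1, hrad t ht] at he
  have hs : 0 < 4 * ((z t - u) * (v - z t)) / (v - u) ^ 2 := by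
    have := hprod t ht
    positivity
  have hq := Real.sq_sqrt hs.le
  have hq0 := Real.sqrt_pos.2 hs
  set q := √(4 * ((z t - u) * (v - z t)) / (v - u) ^ 2) with hqdef
  have h5 : 2 * w t / (v - u) = Real.pi / τ * q := by
    have : Real.pi / 2 - -(Real.pi / 2) = Real.pi := by ring
    rw [this, sub_zero] at he
    rw [← he]; field_simp
  have h6 : w t = Real.pi / τ * q * (v - u) / 2 := by
    rw [← h5]; field_simp
  rw [h6, show (Real.pi / τ * q * (v - u) / 2) ^ 2 = (Real.pi / τ) ^ 2 * (q ^ 2 * (v - u) ^ 2 / 4)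
    by ring, hq]
  field_simp

/-- A function vanishing at both ends of `[u, v]` is positive inside if its second derivative never
becomes nonnegative after having been negative, and either is negative throughout or the function
leaves `u` with positive slope. -/
theorem pos_of_second_deriv {K K' K'' : ℝ → ℝ} {u v : ℝ}
    (h1 : ∀ z ∈ Set.Icc u v, HasDerivAt K (K' z) z)
    (h2 : ∀ z ∈ Set.Icc u v, HasDerivAt K' (K'' z) z) (hu : K u = 0) (hv : K v = 0)
    (hs : ∀ z ∈ Set.Ioo u v, ∀ z' ∈ Set.Ioo u v, z < z' → K'' z < 0 → K'' z' < 0)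
    (h : 0 < K' u ∨ ∀ z ∈ Set.Ioo u v, K'' z < 0) :
    ∀ z ∈ Set.Ioo u v, 0 < K z := by
  intro z hz
  by_contra hcon
  rw [not_lt] at hcon
  have slope : ∀ G G' : ℝ → ℝ, (∀ z ∈ Set.Icc u v, HasDerivAt G (G' z) z) →
      ∀ p q, u ≤ p → p < q → q ≤ v → ∃ c ∈ Set.Ioo p q, G' c = (G q - G p) / (q - p) := by
    intro G G' hG p q hp hpq hq
    have hsub : Set.Icc p q ⊆ Set.Icc u v := Set.Icc_subset_Icc hp hq
    exact exists_hasDerivAt_eq_slope G G' hpq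
      (fun s hs => (hG s (hsub hs)).continuousAt.continuousWithinAt)
      (fun s hs => hG s (hsub (Set.Ioo_subset_Icc_self hs)))
  obtain ⟨c, hc, hc'⟩ := slope K K' h1 u z le_rfl hz.1 hz.2.le
  obtain ⟨d, hd, hd'⟩ := slope K K' h1 z v hz.1.le hz.2 le_rfl
  have hcle : K' c ≤ 0 := by
    rw [hc', hu]
    exact div_nonpos_of_nonpos_of_nonneg (by linarith) (by linarith [hz.1])
  have hdge : 0 ≤ K' d := by
    rw [hd', hv]
    exact div_nonneg (by linarith) (by linarith [hz.2])
  have hcd : c < d := hc.2.trans hd.1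
  obtain ⟨m, hm, hm'⟩ := slope K' K'' h2 c d hc.1.le hcd hd.2.le
  have hmI : m ∈ Set.Ioo u v := ⟨hc.1.trans hm.1, hm.2.trans hd.2⟩
  have hmge : 0 ≤ K'' m := by
    rw [hm']
    exact div_nonneg (by linarith) (by linarith)
  rcases h with h | h
  · obtain ⟨n, hn, hn'⟩ := slope K' K'' h2 u c le_rfl hc.1 (hcd.le.trans hd.2.le)
    have hnneg : K'' n < 0 := by
      rw [hn']
      exact div_neg_of_neg_of_pos (by linarith) (by linarith [hc.1])
    exact absurd (hs n ⟨hn.1, (hn.2.trans hm.1).trans hmI.2⟩ m hmI (hn.2.trans hm.1) hnneg)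
      (not_lt.2 hmge)
  · exact absurd (h m hmI) (not_lt.2 hmge)

/-! ### Positive solutions, symmetry and conservation of the pressure -/

/-- The value of `y²` forced by the level `P` at a point `x > 0`. -/
def speedSq (lam B P x : ℝ) : ℝ := B * x ^ ((2 * lam - 2) / lam) - lam ^ 2 * x ^ 2 - 2 * P

/-- The right-hand side of the equation for `y'` at a point `x > 0`. -/
def force (lam B x : ℝ) : ℝ := -lam ^ 2 * x + (lam - 1) / lam * B * x ^ ((lam - 2) / lam)

/-- A positive elliptic solution on the level `P`, free of absolute values and odd powers. -/
structure IsPositiveSolution (lam B P : ℝ) (x y : ℝ → ℝ) : Prop where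
  pos : ∀ θ, 0 < x θ
  hasDerivAt_fst : ∀ θ, HasDerivAt x (y θ) θ
  hasDerivAt_snd : ∀ θ, HasDerivAt y (force lam B (x θ)) θ
  energy : ∀ θ, y θ ^ 2 = speedSq lam B P (x θ)

theorem hasDerivAt_speedSq {lam x : ℝ} (B P : ℝ) (hlam : lam ≠ 0) (hx : 0 < x) :
    HasDerivAt (speedSq lam B P) (2 * force lam B x) x := by
  have h1 := (Real.hasDerivAt_rpow_const (p := (2 * lam - 2) / lam) (Or.inl hx.ne')).const_mul B
  have h2 := ((hasDerivAt_pow 2 x).const_mul (lam ^ 2))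
  refine ((h1.sub h2).sub_const (2 * P)).congr_deriv ?_
  have e : (2 * lam - 2) / lam - 1 = (lam - 2) / lam := by field_simp; ring
  rw [e, force]
  field_simp
  ring

theorem continuousOn_force (lam B : ℝ) : ContinuousOn (force lam B) (Set.Ioi 0) := by
  intro x hx
  have : ContinuousAt (fun x : ℝ => x ^ ((lam - 2) / lam)) x :=
    Real.continuousAt_rpow_const _ _ (Or.inl (ne_of_gt hx))
  exact ((continuousAt_const.mul continuousAt_id).add
    (continuousAt_const.mul this)).continuousWithinAt

theorem isEllipticAtLevel_iff_of_pos {lam B P : ℝ} {x : ℝ → ℝ} (hx : ∀ θ, 0 < x θ) :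
    IsEllipticAtLevel lam B P x ↔ ∃ y, IsPositiveSolution lam B P x y := by
  have hforce : ∀ θ, -lam ^ 2 * x θ + (lam - 1) / lam * B * signedPow (x θ) ((lam - 2) / lam)
      = force lam B (x θ) := fun θ => by rw [signedPow_of_pos (hx θ), force]
  have hpress : ∀ θ y, pressure lam B (x θ) y = P ↔ y ^ 2 = speedSq lam B P (x θ) := by
    intro θ y
    rw [pressure, speedSq, abs_of_pos (hx θ)]
    constructor <;> intro h <;> linarith
  constructor
  · rintro ⟨y, hs, hP⟩
    exact ⟨y, hx, hs.hasDerivAt_fst, fun θ => hforce θ ▸ hs.hasDerivAt_snd θ,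
      fun θ => (hpress θ _).1 (hP θ)⟩
  · rintro ⟨y, hs⟩
    exact ⟨y, ⟨fun θ => (hx θ).ne', hs.hasDerivAt_fst,
      fun θ => (hforce θ).symm ▸ hs.hasDerivAt_snd θ⟩, fun θ => (hpress θ _).2 (hs.energy θ)⟩

theorem IsEllipticSolution.neg {lam B : ℝ} {x y : ℝ → ℝ} (h : IsEllipticSolution lam B x y) :
    IsEllipticSolution lam B (fun θ => -x θ) (fun θ => -y θ) where
  ne_zero θ := neg_ne_zero.2 (h.ne_zero θ)
  hasDerivAt_fst θ := (h.hasDerivAt_fst θ).neg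
  hasDerivAt_snd θ := (h.hasDerivAt_snd θ).neg.congr_deriv (by rw [signedPow_neg]; ring)

theorem IsEllipticAtLevel.neg {lam B P : ℝ} {x : ℝ → ℝ} (h : IsEllipticAtLevel lam B P x) :
    IsEllipticAtLevel lam B P (fun θ => -x θ) := by
  obtain ⟨y, hs, hP⟩ := h
  refine ⟨_, hs.neg, fun θ => ?_⟩
  rw [← hP θ]
  simp [pressure]

theorem IsEllipticSolution.pos_or_neg {lam B : ℝ} {x y : ℝ → ℝ}
    (h : IsEllipticSolution lam B x y) : (∀ θ, 0 < x θ) ∨ ∀ θ, 0 < -x θ := by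
  by_contra hcon
  push Not at hcon
  obtain ⟨⟨s, hs⟩, t, ht⟩ := hcon
  have hc : Continuous x := continuous_iff_continuousAt.2 fun t => (h.hasDerivAt_fst t).continuousAt
  obtain ⟨u, hu⟩ := mem_range_of_exists_le_of_exists_ge hc ⟨s, hs⟩ ⟨t, by linarith⟩
  exact h.ne_zero u hu

theorem IsEllipticAtLevel.pos_or_neg {lam B P : ℝ} {x : ℝ → ℝ}
    (h : IsEllipticAtLevel lam B P x) : (∀ θ, 0 < x θ) ∨ ∀ θ, 0 < -x θ := by
  obtain ⟨y, hs, -⟩ := h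
  exact hs.pos_or_neg

theorem IsEllipticSolution.exists_level {lam B : ℝ} (hlam : lam ≠ 0) {x y : ℝ → ℝ}
    (h : IsEllipticSolution lam B x y) : ∃ P, IsEllipticAtLevel lam B P x := by
  have key : ∀ x y : ℝ → ℝ, IsEllipticSolution lam B x y → (∀ θ, 0 < x θ) →
      ∃ P, IsEllipticAtLevel lam B P x := by
    intro x y h hx
    have hd : ∀ θ, HasDerivAt (fun θ => speedSq lam B 0 (x θ) - y θ ^ 2) 0 θ := fun θ => by
      have h1 := (hasDerivAt_speedSq B 0 hlam (hx θ)).comp θ (h.hasDerivAt_fst θ)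
      have h2 := (h.hasDerivAt_snd θ).pow 2
      refine (h1.sub h2).congr_deriv ?_
      rw [force, signedPow_of_pos (hx θ)]
      push_cast
      ring
    have hconst : ∀ θ, speedSq lam B 0 (x θ) - y θ ^ 2 = speedSq lam B 0 (x 0) - y 0 ^ 2 :=
      fun θ => is_const_of_deriv_eq_zero (fun t => (hd t).differentiableAt)
        (fun t => (hd t).deriv) θ 0
    refine ⟨(speedSq lam B 0 (x 0) - y 0 ^ 2) / 2, y, h, fun θ => ?_⟩
    have := hconst θ
    rw [← this, pressure, speedSq, abs_of_pos (hx θ)]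
    ring
  rcases h.pos_or_neg with hx | hx
  · exact key x y h hx
  · obtain ⟨P, hP⟩ := key _ _ h.neg hx
    exact ⟨P, by simpa using hP.neg⟩

/-! ### The conjugacy between the parameters `λ` and `1/λ` -/

theorem IsPositiveSolution.conjugate {lam B P : ℝ} (hlam : 0 < lam) {x y : ℝ → ℝ}
    (h : IsPositiveSolution lam B P x y) :
    IsPositiveSolution (1 / lam) (-2 * P / lam ^ 4) (-B / (2 * lam ^ 4))
      (fun θ => x (θ / lam) ^ (1 / lam))
      (fun θ => 1 / lam ^ 2 * (x (θ / lam) ^ (1 / lam - 1) * y (θ / lam))) := by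
  have hl := hlam.ne'
  have hxd : ∀ θ, HasDerivAt (fun θ => x (θ / lam)) (y (θ / lam) / lam) θ := fun θ =>
    ((h.hasDerivAt_fst (θ / lam)).comp θ ((hasDerivAt_id θ).div_const lam)).congr_deriv
      (by field_simp)
  have hyd : ∀ θ, HasDerivAt (fun θ => y (θ / lam)) (force lam B (x (θ / lam)) / lam) θ :=
    fun θ => ((h.hasDerivAt_snd (θ / lam)).comp θ ((hasDerivAt_id θ).div_const lam)).congr_deriv
      (by field_simp)
  -- all powers of `x` that occur are monomials in `x` and `u = x ^ (1 / λ)`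
  have p1 : ∀ z : ℝ, 0 < z → z ^ (1 / lam - 1) = z ^ (1 / lam) / z := fun z hz => by
    rw [Real.rpow_sub hz, Real.rpow_one]
  have p2 : ∀ z : ℝ, 0 < z → z ^ (1 / lam - 1 - 1) = z ^ (1 / lam) / z ^ 2 := fun z hz => by
    rw [Real.rpow_sub hz, p1 z hz, Real.rpow_one]; field_simp
  have p3 : ∀ z : ℝ, 0 < z → z ^ ((lam - 2) / lam) = z / (z ^ (1 / lam)) ^ 2 := fun z hz => by
    rw [show (lam - 2) / lam = 1 - (1 / lam) * 2 by field_simp, Real.rpow_sub hz,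
      Real.rpow_one, Real.rpow_mul hz.le, Real.rpow_two]
  have p4 : ∀ z : ℝ, 0 < z → z ^ ((2 * lam - 2) / lam) = z ^ 2 / (z ^ (1 / lam)) ^ 2 :=
    fun z hz => by
      rw [show (2 * lam - 2) / lam = 2 - (1 / lam) * 2 by field_simp, Real.rpow_sub hz,
        Real.rpow_two, Real.rpow_mul hz.le, Real.rpow_two]
  have p5 : ∀ z : ℝ, 0 < z →
      (z ^ (1 / lam)) ^ ((1 / lam - 2) / (1 / lam)) = z ^ (1 / lam) / z ^ 2 := fun z hz => by
    rw [← p2 z hz, ← Real.rpow_mul hz.le]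
    congr 1; field_simp; ring
  have p6 : ∀ z : ℝ, 0 < z →
      (z ^ (1 / lam)) ^ ((2 * (1 / lam) - 2) / (1 / lam)) = (z ^ (1 / lam)) ^ 2 / z ^ 2 :=
    fun z hz => by
      rw [← Real.rpow_mul hz.le, show 1 / lam * ((2 * (1 / lam) - 2) / (1 / lam))
        = (1 / lam) * 2 - 2 by field_simp, Real.rpow_sub hz, Real.rpow_two,
        Real.rpow_mul hz.le, Real.rpow_two]
  refine ⟨fun θ => Real.rpow_pos_of_pos (h.pos _) _, fun θ => ?_, fun θ => ?_, fun θ => ?_⟩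
  · refine ((hxd θ).rpow_const (p := 1 / lam) (Or.inl (h.pos _).ne')).congr_deriv ?_
    field_simp
  · have hz := h.pos (θ / lam)
    have hE := h.energy (θ / lam)
    refine ((((hxd θ).rpow_const (p := 1 / lam - 1) (Or.inl hz.ne')).mul
      (hyd θ)).const_mul (1 / lam ^ 2)).congr_deriv ?_
    have hu : 0 < x (θ / lam) ^ (1 / lam) := Real.rpow_pos_of_pos hz _
    rw [speedSq, p4 _ hz] at hE
    rw [force, force, p5 _ hz, p3 _ hz, p2 _ hz, p1 _ hz]
    set z := x (θ / lam)
    set u := z ^ (1 / lam)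
    set w := y (θ / lam)
    have e1 : w / lam * (1 / lam - 1) * (u / z ^ 2) * w
        = w ^ 2 * (1 / lam * (1 / lam - 1) * (u / z ^ 2)) := by ring
    rw [e1, hE]
    field_simp
    ring
  · have hz := h.pos (θ / lam)
    have hE := h.energy (θ / lam)
    have hu : 0 < x (θ / lam) ^ (1 / lam) := Real.rpow_pos_of_pos hz _
    rw [speedSq, p4 _ hz] at hE
    rw [mul_pow, mul_pow, hE, speedSq, p6 _ hz, p1 _ hz]
    field_simp
    ring

theorem signedPow_inverse {a : ℝ} (ha : a ≠ 0) {x : ℝ} (hx : x ≠ 0) :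
    signedPow (signedPow x a) (1 / a) = x := by
  have key : ∀ z : ℝ, 0 < z → signedPow (signedPow z a) (1 / a) = z := fun z hz => by
    rw [signedPow_of_pos hz, signedPow_of_pos (Real.rpow_pos_of_pos hz _), ← Real.rpow_mul hz.le,
      mul_one_div_cancel ha, Real.rpow_one]
  rcases lt_or_gt_of_ne hx with h | h
  · have := key (-x) (neg_pos.2 h)
    rw [signedPow_neg, signedPow_neg] at this
    linarith
  · exact key x h

theorem conjugate_neg (lam : ℝ) (x : ℝ → ℝ) :
    conjugate lam (fun θ => -x θ) = fun θ => -conjugate lam x θ := by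
  funext θ
  simp only [conjugate, signedPow_neg]

theorem conjugate_of_pos {lam : ℝ} {x : ℝ → ℝ} (hx : ∀ θ, 0 < x θ) :
    conjugate lam x = fun θ => x (θ / lam) ^ (1 / lam) := by
  funext θ
  rw [conjugate, signedPow_of_pos (hx _)]

theorem conjugate_conjugate {lam : ℝ} (hlam : 0 < lam) {x : ℝ → ℝ} (hx : ∀ θ, x θ ≠ 0) :
    conjugate (1 / lam) (conjugate lam x) = x := by
  funext θ
  simp only [conjugate]
  rw [show θ / (1 / lam) / lam = θ by field_simp]
  exact signedPow_inverse (one_div_pos.2 hlam).ne' (hx θ)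

theorem IsEllipticAtLevel.conjugate {lam B P : ℝ} (hlam : 0 < lam) {x : ℝ → ℝ}
    (h : IsEllipticAtLevel lam B P x) :
    IsEllipticAtLevel (1 / lam) (-2 * P / lam ^ 4) (-B / (2 * lam ^ 4)) (conjugate lam x) := by
  have key : ∀ x : ℝ → ℝ, IsEllipticAtLevel lam B P x → (∀ θ, 0 < x θ) →
      IsEllipticAtLevel (1 / lam) (-2 * P / lam ^ 4) (-B / (2 * lam ^ 4))
        (_root_.conjugate lam x) := by
    intro x h hx
    obtain ⟨y, hy⟩ := (isEllipticAtLevel_iff_of_pos hx).1 h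
    rw [conjugate_of_pos hx]
    exact (isEllipticAtLevel_iff_of_pos fun θ => Real.rpow_pos_of_pos (hx _) _).2
      ⟨_, hy.conjugate hlam⟩
  rcases h.pos_or_neg with hx | hx
  · exact key x h hx
  · have := (key _ h.neg hx).neg
    rw [conjugate_neg] at this
    simpa using this

/-- The nowhere vanishing of `x`, needed to invert the conjugacy, follows from that of its
conjugate because `signedPow 0 (1 / λ) = 0`. -/
theorem isEllipticAtLevel_conjugate_iff {lam B P : ℝ} (hlam : 0 < lam) (x : ℝ → ℝ) :
    IsEllipticAtLevel lam B P x ↔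
      IsEllipticAtLevel (1 / lam) (-2 * P / lam ^ 4) (-B / (2 * lam ^ 4)) (conjugate lam x) := by
  refine ⟨fun h => h.conjugate hlam, fun h => ?_⟩
  have hx : ∀ θ, x θ ≠ 0 := fun θ h0 => by
    obtain ⟨y, hs, -⟩ := h
    refine hs.ne_zero (θ * lam) ?_
    rw [conjugate, mul_div_cancel_right₀ _ hlam.ne', h0]
    simp [signedPow]
  have h' := h.conjugate (one_div_pos.2 hlam)
  rw [conjugate_conjugate hlam hx] at h'
  convert h' using 1 <;> field_simp

/-! ### Turning points for `1 < λ < 2` and `B > 0` -/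

/-- The positive equilibrium. -/
def equilibrium (lam B : ℝ) : ℝ := ((lam - 1) * B / lam ^ 3) ^ (lam / 2)

theorem rpow_speed_exponent {lam x : ℝ} (hlam : lam ≠ 0) (hx : 0 < x) :
    x ^ ((2 * lam - 2) / lam) = x ^ 2 / x ^ (2 / lam) := by
  rw [show (2 * lam - 2) / lam = 2 - 2 / lam by field_simp, Real.rpow_sub hx, Real.rpow_two]

theorem speedSq_eq {lam x : ℝ} (B P : ℝ) (hlam : lam ≠ 0) (hx : 0 < x) :
    speedSq lam B P x = x ^ 2 * (B / x ^ (2 / lam) - lam ^ 2) - 2 * P := by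
  rw [speedSq, rpow_speed_exponent hlam hx]; ring

theorem force_eq {lam x : ℝ} (B : ℝ) (hlam : lam ≠ 0) (hx : 0 < x) :
    force lam B x = x * ((lam - 1) / lam * B / x ^ (2 / lam) - lam ^ 2) := by
  rw [force, show (lam - 2) / lam = 1 - 2 / lam by field_simp, Real.rpow_sub hx, Real.rpow_one]
  ring

section

variable {lam B : ℝ}

theorem equilibrium_pos (h1 : 1 < lam) (hB : 0 < B) : 0 < equilibrium lam B :=
  Real.rpow_pos_of_pos (div_pos (mul_pos (sub_pos.2 h1) hB) (by positivity)) _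

theorem equilibrium_rpow (h1 : 1 < lam) (hB : 0 < B) :
    equilibrium lam B ^ (2 / lam) = (lam - 1) * B / lam ^ 3 := by
  have hK : 0 < (lam - 1) * B / lam ^ 3 := div_pos (mul_pos (sub_pos.2 h1) hB) (by positivity)
  rw [equilibrium, ← Real.rpow_mul hK.le, show lam / 2 * (2 / lam) = 1 by field_simp,
    Real.rpow_one]

theorem force_pos (h1 : 1 < lam) (hB : 0 < B) {x : ℝ} (hx : 0 < x)
    (hxe : x < equilibrium lam B) : 0 < force lam B x := by
  have hl : 0 < lam := by linarith
  have ht := Real.rpow_lt_rpow hx.le hxe (show 0 < 2 / lam by positivity)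
  rw [equilibrium_rpow h1 hB, lt_div_iff₀ (by positivity)] at ht
  have ht0 := Real.rpow_pos_of_pos hx (2 / lam)
  rw [force_eq B hl.ne' hx]
  refine mul_pos hx (sub_pos.2 ?_)
  rw [lt_div_iff₀ ht0, div_mul_eq_mul_div, lt_div_iff₀ hl]
  linarith

theorem force_neg (h1 : 1 < lam) (hB : 0 < B) {x : ℝ}
    (hxe : equilibrium lam B < x) : force lam B x < 0 := by
  have hl : 0 < lam := by linarith
  have he := equilibrium_pos h1 hB
  have hx := he.trans hxe
  have ht := Real.rpow_lt_rpow he.le hxe (show 0 < 2 / lam by positivity)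
  rw [equilibrium_rpow h1 hB, div_lt_iff₀ (by positivity)] at ht
  have ht0 := Real.rpow_pos_of_pos hx (2 / lam)
  rw [force_eq B hl.ne' hx]
  refine mul_neg_of_pos_of_neg hx (sub_neg.2 ?_)
  rw [div_lt_iff₀ ht0, div_mul_eq_mul_div, div_lt_iff₀ hl]
  linarith

theorem speedSq_lt_of_le_equilibrium (h1 : 1 < lam) (hB : 0 < B) (P : ℝ) {u v : ℝ} (hu : 0 < u)
    (huv : u < v) (hv : v ≤ equilibrium lam B) : speedSq lam B P u < speedSq lam B P v := by
  have hd : ∀ x, 0 < x → HasDerivAt (speedSq lam B P) (2 * force lam B x) x := fun x hx =>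
    hasDerivAt_speedSq B P (by linarith) hx
  refine strictMonoOn_of_deriv_pos (convex_Icc u v)
    (fun x hx => (hd x (hu.trans_le hx.1)).continuousAt.continuousWithinAt) (fun x hx => ?_)
    ⟨le_rfl, huv.le⟩ ⟨huv.le, le_rfl⟩ huv
  rw [interior_Icc] at hx
  rw [(hd x (hu.trans hx.1)).deriv]
  have := force_pos h1 hB (hu.trans hx.1) (hx.2.trans_le hv)
  linarith

theorem speedSq_lt_of_equilibrium_le (h1 : 1 < lam) (hB : 0 < B) (P : ℝ) {u v : ℝ}
    (hu : equilibrium lam B ≤ u) (huv : u < v) : speedSq lam B P v < speedSq lam B P u := by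
  have hu0 := (equilibrium_pos h1 hB).trans_le hu
  have hd : ∀ x, 0 < x → HasDerivAt (speedSq lam B P) (2 * force lam B x) x := fun x hx =>
    hasDerivAt_speedSq B P (by linarith) hx
  refine strictAntiOn_of_deriv_neg (convex_Icc u v)
    (fun x hx => (hd x (hu0.trans_le hx.1)).continuousAt.continuousWithinAt) (fun x hx => ?_)
    ⟨le_rfl, huv.le⟩ ⟨huv.le, le_rfl⟩ huv
  rw [interior_Icc] at hx
  rw [(hd x (hu0.trans hx.1)).deriv]
  have := force_neg h1 hB (hu.trans_lt hx.1)
  linarith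

theorem speedSq_equilibrium (h1 : 1 < lam) (hB : 0 < B) (P : ℝ) :
    speedSq lam B P (equilibrium lam B) = 2 * (maxPressure lam B - P) := by
  have hl : 0 < lam := by linarith
  have hl1 : 0 < lam - 1 := by linarith
  have hK : 0 < (lam - 1) * B / lam ^ 3 := by positivity
  have hsq : equilibrium lam B ^ 2 = ((lam - 1) * B / lam ^ 3) ^ lam := by
    rw [equilibrium, ← Real.rpow_two, ← Real.rpow_mul hK.le]
    congr 1; ring
  rw [speedSq_eq B P hl.ne' (equilibrium_pos h1 hB), equilibrium_rpow h1 hB, hsq, maxPressure,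
    Real.rpow_sub hK, Real.rpow_one]
  field_simp
  ring

theorem speedSq_zero_pos (h1 : 1 < lam) (hB : 0 < B) {x : ℝ} (hx : 0 < x)
    (hxe : x ≤ equilibrium lam B) : 0 < speedSq lam B 0 x := by
  have hl : 0 < lam := by linarith
  have ht := Real.rpow_le_rpow hx.le hxe (show 0 ≤ 2 / lam by positivity)
  rw [equilibrium_rpow h1 hB, le_div_iff₀ (by positivity)] at ht
  have ht0 := Real.rpow_pos_of_pos hx (2 / lam)
  rw [speedSq_eq B 0 hl.ne' hx, mul_zero, sub_zero]
  refine mul_pos (by positivity) (sub_pos.2 ?_)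
  rw [lt_div_iff₀ ht0]
  by_contra hcon
  rw [not_lt] at hcon
  nlinarith

/-- `a < b` are the two positive zeros of `y²` on the level `P`; the last field is an upper bound
for `b` which does not depend on `P`. -/
structure AreTurningPoints (lam B P a b : ℝ) : Prop where
  pos : 0 < a
  left_lt : a < equilibrium lam B
  lt_right : equilibrium lam B < b
  speedSq_left : speedSq lam B P a = 0
  speedSq_right : speedSq lam B P b = 0
  right_lt : b < (B / lam ^ 2) ^ (lam / 2)

theorem exists_turningPoints (h1 : 1 < lam) (hB : 0 < B) {P : ℝ} (hP : 0 < P)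
    (hPm : P < maxPressure lam B) : ∃ a b, AreTurningPoints lam B P a b := by
  have hl : 0 < lam := by linarith
  have he := equilibrium_pos h1 hB
  have hs : 0 < (2 * lam - 2) / lam := div_pos (by linarith) hl
  have hc : Continuous (speedSq lam B P) := by
    have := Real.continuous_rpow_const hs.le
    unfold speedSq
    fun_prop
  have hFe : 0 < speedSq lam B P (equilibrium lam B) := by
    rw [speedSq_equilibrium h1 hB]; linarith
  have hF0 : speedSq lam B P 0 < 0 := by
    rw [speedSq, Real.zero_rpow hs.ne']; linarith
  have hBl : 0 < B / lam ^ 2 := by positivity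
  have hK0 : 0 ≤ (lam - 1) * B / lam ^ 3 :=
    div_nonneg (mul_nonneg (by linarith) hB.le) (by positivity)
  have heX : equilibrium lam B < (B / lam ^ 2) ^ (lam / 2) := by
    refine Real.rpow_lt_rpow hK0 ?_ (by positivity)
    rw [div_lt_div_iff₀ (by positivity) (by positivity)]
    nlinarith [mul_pos hB (pow_pos hl 2)]
  have hFX : speedSq lam B P ((B / lam ^ 2) ^ (lam / 2)) < 0 := by
    rw [speedSq_eq B P hl.ne' (he.trans heX), ← Real.rpow_mul hBl.le,
      show lam / 2 * (2 / lam) = 1 by field_simp, Real.rpow_one,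
      show B / (B / lam ^ 2) - lam ^ 2 = 0 by field_simp; ring]
    linarith
  obtain ⟨a, ha, ha'⟩ := intermediate_value_Ioo he.le hc.continuousOn ⟨hF0, hFe⟩
  obtain ⟨b, hb, hb'⟩ := intermediate_value_Ioo' heX.le hc.continuousOn ⟨hFX, hFe⟩
  exact ⟨a, b, ha.1, ha.2, hb.1, ha', hb', hb.2⟩

namespace AreTurningPoints

variable {P a b : ℝ}

theorem lt (h : AreTurningPoints lam B P a b) : a < b := h.left_lt.trans h.lt_right

theorem speedSq_pos (h : AreTurningPoints lam B P a b) (h1 : 1 < lam) (hB : 0 < B) {x : ℝ}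
    (hx : x ∈ Set.Ioo a b) : 0 < speedSq lam B P x := by
  rcases le_total x (equilibrium lam B) with hle | hle
  · rw [← h.speedSq_left]
    exact speedSq_lt_of_le_equilibrium h1 hB P h.pos hx.1 hle
  · rw [← h.speedSq_right]
    exact speedSq_lt_of_equilibrium_le h1 hB P hle hx.2

theorem mem_Icc (h : AreTurningPoints lam B P a b) (h1 : 1 < lam) (hB : 0 < B) {x : ℝ}
    (hx : 0 < x) (hF : 0 ≤ speedSq lam B P x) : x ∈ Set.Icc a b := by
  constructor
  · by_contra hcon
    have := speedSq_lt_of_le_equilibrium h1 hB P hx (not_le.1 hcon) h.left_lt.le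
    rw [h.speedSq_left] at this
    linarith
  · by_contra hcon
    have := speedSq_lt_of_equilibrium_le h1 hB P h.lt_right.le (not_le.1 hcon)
    rw [h.speedSq_right] at this
    linarith

theorem exists_isOscillation (h : AreTurningPoints lam B P a b) (h1 : 1 < lam) (hB : 0 < B) :
    ∃ (τ : ℝ) (X Y : ℝ → ℝ), IsOscillation (speedSq lam B P) (force lam B) a b τ X Y :=
  _root_.exists_isOscillation h.lt
    (fun _ hx => hasDerivAt_speedSq B P (by linarith) (h.pos.trans_le hx.1))
    ((continuousOn_force lam B).mono fun _ hx => h.pos.trans_le hx.1)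
    h.speedSq_left h.speedSq_right (fun _ hx => h.speedSq_pos h1 hB hx)
    (force_pos h1 hB h.pos h.left_lt) (force_neg h1 hB h.lt_right)

end AreTurningPoints

/-! ### The period function as the period of an explicit oscillation -/

theorem exists_lipschitzOnWith_force (lam B : ℝ) {a b : ℝ} (ha : 0 < a) :
    ∃ K, LipschitzOnWith K (force lam B) (Set.Icc a b) := by
  have hc : ContDiffOn ℝ 1 (force lam B) (Set.Icc a b) := by
    have : ContDiffOn ℝ 1 (fun x : ℝ => x ^ ((lam - 2) / lam)) (Set.Icc a b) :=
      contDiffOn_id.rpow_const_of_ne fun x hx => (ha.trans_le hx.1).ne'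
    exact (contDiffOn_const.mul contDiffOn_id).add (contDiffOn_const.mul this)
  exact hc.exists_lipschitzOnWith one_ne_zero (convex_Icc a b) isCompact_Icc

variable {P a b τ : ℝ} {X Y : ℝ → ℝ}

theorem IsOscillation.isEllipticAtLevel (h : AreTurningPoints lam B P a b)
    (ho : IsOscillation (speedSq lam B P) (force lam B) a b τ X Y) :
    IsEllipticAtLevel lam B P X := by
  have hpos : ∀ θ, 0 < X θ := fun θ => h.pos.trans_le (ho.mem_Icc θ).1
  exact (isEllipticAtLevel_iff_of_pos hpos).2
    ⟨Y, hpos, ho.hasDerivAt_fst, ho.hasDerivAt_snd, ho.energy⟩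

theorem periodic_iff_of_isOscillation (h1 : 1 < lam) (hB : 0 < B)
    (h : AreTurningPoints lam B P a b)
    (ho : IsOscillation (speedSq lam B P) (force lam B) a b τ X Y)
    {x : ℝ → ℝ} (hx : IsEllipticAtLevel lam B P x) (S : ℝ) :
    Function.Periodic x S ↔ Function.Periodic X S := by
  have key : ∀ x : ℝ → ℝ, IsEllipticAtLevel lam B P x → (∀ θ, 0 < x θ) →
      (Function.Periodic x S ↔ Function.Periodic X S) := by
    intro x hx hpos
    obtain ⟨y, hy⟩ := (isEllipticAtLevel_iff_of_pos hpos).1 hx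
    obtain ⟨K, hK⟩ := exists_lipschitzOnWith_force lam B (b := b) h.pos
    obtain ⟨t₀, ht⟩ := ho.exists_eq_shift hK hy.hasDerivAt_fst hy.hasDerivAt_snd hy.energy
      fun t => h.mem_Icc h1 hB (hy.pos t) (hy.energy t ▸ sq_nonneg _)
    constructor
    · intro hp t
      have := hp (t - t₀)
      rw [ht, ht] at this
      rwa [show t - t₀ + S + t₀ = t + S by ring, sub_add_cancel] at this
    · intro hp t
      rw [ht, ht, add_right_comm, hp]
  rcases hx.pos_or_neg with hpos | hpos
  · exact key x hx hpos
  · rw [← key _ hx.neg hpos]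
    exact forall_congr' fun t => neg_inj.symm

theorem isLeast_period_of_isOscillation (h1 : 1 < lam) (hB : 0 < B)
    (h : AreTurningPoints lam B P a b)
    (ho : IsOscillation (speedSq lam B P) (force lam B) a b τ X Y)
    {x : ℝ → ℝ} (hx : IsEllipticAtLevel lam B P x) :
    IsLeast {T : ℝ | 0 < T ∧ Function.Periodic x T} (2 * τ) := by
  have hτ := ho.half_pos
  refine ⟨⟨by positivity, (periodic_iff_of_isOscillation h1 hB h ho hx _).2 ho.periodic⟩, ?_⟩
  rintro S ⟨hS, hp⟩
  have hp' := (periodic_iff_of_isOscillation h1 hB h ho hx S).1 hp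
  exact ho.return_le S hS (by rw [← ho.map_zero, ← hp' 0, zero_add])

theorem periodFunction_eq_of_isOscillation (h1 : 1 < lam) (hB : 0 < B)
    (h : AreTurningPoints lam B P a b)
    (ho : IsOscillation (speedSq lam B P) (force lam B) a b τ X Y) :
    periodFunction lam B P = 2 * τ := by
  refine IsLeast.csInf_eq ⟨?_, ?_⟩
  · obtain ⟨h0, hp⟩ := (isLeast_period_of_isOscillation h1 hB h ho (ho.isEllipticAtLevel h)).1
    exact ⟨h0, X, ho.isEllipticAtLevel h, hp⟩
  · rintro S ⟨hS, x, hx, hp⟩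
    exact (isLeast_period_of_isOscillation h1 hB h ho hx).2 ⟨hS, hp⟩

end

/-! ### Comparison in power coordinates -/

/-- The function `R_α`. In the coordinate `z = x ^ α` the speed satisfies `z'² = H z` for a
combination `H` of three powers, and `R_α x = -H''(x ^ α) / 2`. It would be the constant squared
frequency if `z` moved harmonically. -/
def coordFreqSq (lam B P α x : ℝ) : ℝ :=
  2 * P * ((α - 1) * (α - 2)) / x ^ 2 - B * ((α - 1 / lam) * (α - 2 / lam)) / x ^ (2 / lam)
    + lam ^ 2 * α ^ 2

/-- The squared speed of `z = x ^ α` as a function of `z`. -/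
def coordSpeedSq (lam B P α z : ℝ) : ℝ :=
  α ^ 2 * (B * z ^ (2 - 2 / (lam * α)) - lam ^ 2 * z ^ 2 - 2 * P * z ^ (2 - 2 / α))

/-- The derivative of `coordSpeedSq`. -/
def coordSpeedSqDeriv (lam B P α z : ℝ) : ℝ :=
  α ^ 2 * (B * ((2 - 2 / (lam * α)) * z ^ (1 - 2 / (lam * α))) - lam ^ 2 * (2 * z)
    - 2 * P * ((2 - 2 / α) * z ^ (1 - 2 / α)))

section

variable {lam B P α : ℝ}

theorem hasDerivAt_coordSpeedSq {z : ℝ} (hz : 0 < z) :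
    HasDerivAt (coordSpeedSq lam B P α) (coordSpeedSqDeriv lam B P α z) z := by
  have h1 := (Real.hasDerivAt_rpow_const (p := 2 - 2 / (lam * α)) (Or.inl hz.ne')).const_mul B
  have h2 := (Real.hasDerivAt_rpow_const (p := 2 - 2 / α) (Or.inl hz.ne')).const_mul (2 * P)
  have h3 := (hasDerivAt_pow 2 z).const_mul (lam ^ 2)
  refine (((h1.sub h3).sub h2).const_mul (α ^ 2)).congr_deriv ?_
  rw [coordSpeedSqDeriv, show 2 - 2 / (lam * α) - 1 = 1 - 2 / (lam * α) by ring,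
    show 2 - 2 / α - 1 = 1 - 2 / α by ring]
  norm_num

theorem hasDerivAt_coordSpeedSqDeriv (hlam : 0 < lam) (hα : 0 < α) {z : ℝ} (hz : 0 < z) :
    HasDerivAt (coordSpeedSqDeriv lam B P α) (-2 * coordFreqSq lam B P α (z ^ (1 / α))) z := by
  have h1 := ((Real.hasDerivAt_rpow_const (p := 1 - 2 / (lam * α)) (Or.inl hz.ne')).const_mul
    (2 - 2 / (lam * α))).const_mul B
  have h2 := ((Real.hasDerivAt_rpow_const (p := 1 - 2 / α) (Or.inl hz.ne')).const_mul
    (2 - 2 / α)).const_mul (2 * P)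
  have h3 := ((hasDerivAt_id z).const_mul 2).const_mul (lam ^ 2)
  refine (((h1.sub h3).sub h2).const_mul (α ^ 2)).congr_deriv ?_
  have e1 : z ^ (1 - 2 / (lam * α) - 1) = ((z ^ (1 / α)) ^ (2 / lam))⁻¹ := by
    rw [← Real.rpow_mul hz.le, ← Real.rpow_neg hz.le]
    congr 1; field_simp; ring
  have e2 : z ^ (1 - 2 / α - 1) = ((z ^ (1 / α)) ^ 2)⁻¹ := by
    rw [← Real.rpow_two, ← Real.rpow_mul hz.le, ← Real.rpow_neg hz.le]
    congr 1; field_simp; ring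
  rw [e1, e2, coordFreqSq]
  have hx : 0 < z ^ (1 / α) := Real.rpow_pos_of_pos hz _
  have ht : 0 < (z ^ (1 / α)) ^ (2 / lam) := Real.rpow_pos_of_pos hx _
  set x := z ^ (1 / α)
  set t := x ^ (2 / lam)
  field_simp
  ring

theorem coordSpeedSq_rpow (hlam : 0 < lam) (hα : 0 < α) {x : ℝ} (hx : 0 < x) :
    coordSpeedSq lam B P α (x ^ α) = (α * x ^ (α - 1)) ^ 2 * speedSq lam B P x := by
  have e1 : (x ^ α) ^ (2 - 2 / (lam * α)) = (x ^ α) ^ 2 / x ^ (2 / lam) := by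
    rw [← Real.rpow_two, ← Real.rpow_mul hx.le, ← Real.rpow_mul hx.le, ← Real.rpow_sub hx]
    congr 1; field_simp
  have e2 : (x ^ α) ^ (2 - 2 / α) = (x ^ α) ^ 2 / x ^ 2 := by
    rw [← Real.rpow_two, ← Real.rpow_two, ← Real.rpow_mul hx.le, ← Real.rpow_mul hx.le,
      ← Real.rpow_sub hx]
    congr 1; field_simp
  have ht : 0 < x ^ (2 / lam) := Real.rpow_pos_of_pos hx _
  rw [coordSpeedSq, e1, e2, speedSq_eq B P hlam.ne' hx, Real.rpow_sub hx, Real.rpow_one]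
  field_simp

theorem coordSpeedSqDeriv_rpow (hlam : 0 < lam) (hα : 0 < α) {x : ℝ} (hx : 0 < x)
    (hF : speedSq lam B P x = 0) :
    coordSpeedSqDeriv lam B P α (x ^ α)
      = 2 * α * (x ^ α * ((lam - 1) / lam * B / x ^ (2 / lam) - lam ^ 2)) := by
  have e1 : (x ^ α) ^ (1 - 2 / (lam * α)) = x ^ α / x ^ (2 / lam) := by
    rw [← Real.rpow_mul hx.le, ← Real.rpow_sub hx]
    congr 1; field_simp
  have e2 : (x ^ α) ^ (1 - 2 / α) = x ^ α / x ^ 2 := by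
    rw [← Real.rpow_two, ← Real.rpow_mul hx.le, ← Real.rpow_sub hx]
    congr 1; field_simp
  have ht : 0 < x ^ (2 / lam) := Real.rpow_pos_of_pos hx _
  rw [speedSq_eq B P hlam.ne' hx] at hF
  have hP : 2 * P = x ^ 2 * (B / x ^ (2 / lam) - lam ^ 2) := by linarith
  rw [coordSpeedSqDeriv, e1, e2, hP]
  field_simp
  ring

variable {a b τ : ℝ} {X Y : ℝ → ℝ}

/-- `exists_speed_sq_eq` for the rising half of an oscillation in the coordinate `x ^ α`. -/
theorem IsOscillation.exists_coordSpeedSq_eq (h : AreTurningPoints lam B P a b)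
    (ho : IsOscillation (speedSq lam B P) (force lam B) a b τ X Y) (hlam : 0 < lam) (hα : 0 < α) :
    ∃ z ∈ Set.Ioo (a ^ α) (b ^ α),
      coordSpeedSq lam B P α z = (Real.pi / τ) ^ 2 * ((z - a ^ α) * (b ^ α - z)) := by
  have hX : ∀ t, 0 < X t := fun t => h.pos.trans_le (ho.mem_Icc t).1
  have hI : ∀ t ∈ Set.Ioo 0 τ, X t ∈ Set.Ioo a b := fun t ht => by
    have hY := pow_pos (ho.rising t ht) 2
    rw [ho.energy] at hY
    obtain ⟨hl, hr⟩ := ho.mem_Icc t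
    refine ⟨lt_of_le_of_ne hl fun e => ?_, lt_of_le_of_ne hr fun e => ?_⟩
    · rw [← e, h.speedSq_left] at hY; exact lt_irrefl _ hY
    · rw [e, h.speedSq_right] at hY; exact lt_irrefl _ hY
  have hIz : ∀ t ∈ Set.Ioo 0 τ, X t ^ α ∈ Set.Ioo (a ^ α) (b ^ α) := fun t ht =>
    ⟨Real.rpow_lt_rpow h.pos.le (hI t ht).1 hα, Real.rpow_lt_rpow (hX t).le (hI t ht).2 hα⟩
  obtain ⟨t, ht, he⟩ := exists_speed_sq_eq (z := fun t => X t ^ α)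
    (w := fun t => Y t * α * X t ^ (α - 1)) ho.half_pos
    (ho.continuous.rpow_const fun t => Or.inl (hX t).ne') (by rw [ho.map_zero])
    (by rw [ho.map_half])
    (fun t _ => (ho.hasDerivAt_fst t).rpow_const (Or.inl (hX t).ne')) hIz
  refine ⟨X t ^ α, hIz t ht, ?_⟩
  rw [← he, coordSpeedSq_rpow hlam hα (hX t), ← ho.energy]
  ring

theorem rpow_one_div_mem_Ioo (ha : 0 < a) (hα : 0 < α) {z : ℝ}
    (hz : z ∈ Set.Ioo (a ^ α) (b ^ α)) (hb : 0 < b) : z ^ (1 / α) ∈ Set.Ioo a b := by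
  have hz0 : 0 < z := (Real.rpow_pos_of_pos ha α).trans hz.1
  have hinv : ∀ c : ℝ, 0 < c → (c ^ α) ^ (1 / α) = c := fun c hc => by
    rw [← Real.rpow_mul hc.le, mul_one_div_cancel hα.ne', Real.rpow_one]
  constructor
  · have := Real.rpow_lt_rpow (Real.rpow_nonneg ha.le α) hz.1 (one_div_pos.2 hα)
    rwa [hinv a ha] at this
  · have := Real.rpow_lt_rpow hz0.le hz.2 (one_div_pos.2 hα)
    rwa [hinv b hb] at this

/-- If `R_α > κ`, then the oscillation is faster than the harmonic one of squared frequency `κ`.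
It also suffices that `R_α - κ` stays positive once it is, provided that `z = x ^ α` starts from
its left turning point with a larger acceleration than the harmonic motion. -/
theorem IsOscillation.lt_freqSq (h : AreTurningPoints lam B P a b)
    (ho : IsOscillation (speedSq lam B P) (force lam B) a b τ X Y) (hlam : 0 < lam) (hα : 0 < α)
    {κ : ℝ}
    (hs : ∀ x ∈ Set.Ioo a b, ∀ x' ∈ Set.Ioo a b, x < x' → κ < coordFreqSq lam B P α x →
      κ < coordFreqSq lam B P α x')
    (hκ : κ * (b ^ α - a ^ α) < 2 * α * (a ^ α * ((lam - 1) / lam * B / a ^ (2 / lam) - lam ^ 2))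
      ∨ ∀ x ∈ Set.Ioo a b, κ < coordFreqSq lam B P α x) :
    κ < (Real.pi / τ) ^ 2 := by
  obtain ⟨z, hz, he⟩ := ho.exists_coordSpeedSq_eq h hlam hα
  have hb := h.pos.trans h.lt
  have hu := Real.rpow_pos_of_pos h.pos α
  have hmem := fun z hz => rpow_one_div_mem_Ioo (z := z) h.pos hα hz hb
  have hprod := mul_pos (sub_pos.2 hz.1) (sub_pos.2 hz.2)
  have key := pos_of_second_deriv (u := a ^ α) (v := b ^ α)
    (K := fun z => coordSpeedSq lam B P α z - κ * ((z - a ^ α) * (b ^ α - z)))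
    (K' := fun z => coordSpeedSqDeriv lam B P α z - κ * (a ^ α + b ^ α - 2 * z))
    (K'' := fun z => -2 * coordFreqSq lam B P α (z ^ (1 / α)) + 2 * κ)
    (fun z hz => by
      refine ((hasDerivAt_coordSpeedSq (hu.trans_le hz.1)).sub ((((hasDerivAt_id z).sub_const
        (a ^ α)).mul ((hasDerivAt_id z).const_sub (b ^ α))).const_mul κ)).congr_deriv ?_
      simp only [id]; ring)
    (fun z hz => by
      refine ((hasDerivAt_coordSpeedSqDeriv hlam hα (hu.trans_le hz.1)).sub
        ((((hasDerivAt_id z).const_mul 2).const_sub (a ^ α + b ^ α)).const_mul κ)).congr_deriv ?_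
      ring)
    (by simp only [coordSpeedSq_rpow hlam hα h.pos, h.speedSq_left]; ring)
    (by simp only [coordSpeedSq_rpow hlam hα hb, h.speedSq_right]; ring)
    (fun z hz z' hz' hlt hneg => by
      have hz0 : 0 < z := hu.trans hz.1
      have := hs _ (hmem z hz) _ (hmem z' hz')
        (Real.rpow_lt_rpow hz0.le hlt (one_div_pos.2 hα)) (by linarith)
      linarith)
    (hκ.imp
      (fun hκ => by
        simp only [coordSpeedSqDeriv_rpow hlam hα h.pos h.speedSq_left]
        linarith)
      (fun hκ z hz => by
        have := hκ _ (hmem z hz)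
        linarith))
    z hz
  simp only [he] at key
  exact lt_of_mul_lt_mul_right (sub_pos.1 key) hprod.le

theorem IsOscillation.freqSq_lt (h : AreTurningPoints lam B P a b)
    (ho : IsOscillation (speedSq lam B P) (force lam B) a b τ X Y) (hlam : 0 < lam) (hα : 0 < α)
    {κ : ℝ} (hκ : ∀ x ∈ Set.Ioo a b, coordFreqSq lam B P α x < κ) :
    (Real.pi / τ) ^ 2 < κ := by
  obtain ⟨z, hz, he⟩ := ho.exists_coordSpeedSq_eq h hlam hα
  have hb := h.pos.trans h.lt
  have hu := Real.rpow_pos_of_pos h.pos α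
  have hmem := fun z hz => rpow_one_div_mem_Ioo (z := z) h.pos hα hz hb
  have hprod := mul_pos (sub_pos.2 hz.1) (sub_pos.2 hz.2)
  have hneg : ∀ z ∈ Set.Ioo (a ^ α) (b ^ α),
      2 * coordFreqSq lam B P α (z ^ (1 / α)) - 2 * κ < 0 := fun z hz => by
    have := hκ _ (hmem z hz)
    linarith
  have key := pos_of_second_deriv (u := a ^ α) (v := b ^ α)
    (K := fun z => κ * ((z - a ^ α) * (b ^ α - z)) - coordSpeedSq lam B P α z)
    (K' := fun z => κ * (a ^ α + b ^ α - 2 * z) - coordSpeedSqDeriv lam B P α z)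
    (K'' := fun z => 2 * coordFreqSq lam B P α (z ^ (1 / α)) - 2 * κ)
    (fun z hz => by
      refine (((((hasDerivAt_id z).sub_const (a ^ α)).mul
        ((hasDerivAt_id z).const_sub (b ^ α))).const_mul κ).sub
        (hasDerivAt_coordSpeedSq (hu.trans_le hz.1))).congr_deriv ?_
      simp only [id]; ring)
    (fun z hz => by
      refine (((((hasDerivAt_id z).const_mul 2).const_sub (a ^ α + b ^ α)).const_mul κ).sub
        (hasDerivAt_coordSpeedSqDeriv hlam hα (hu.trans_le hz.1))).congr_deriv ?_
      ring)
    (by simp only [coordSpeedSq_rpow hlam hα h.pos, h.speedSq_left]; ring)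
    (by simp only [coordSpeedSq_rpow hlam hα hb, h.speedSq_right]; ring)
    (fun z _ z' hz' _ _ => hneg z' hz') (Or.inr hneg) z hz
  simp only [he] at key
  exact lt_of_mul_lt_mul_right (sub_pos.1 key) hprod.le

/-! ### Bounds for the period -/

/-- In the coordinate `x ^ (2 / λ)` the limiting motion for `P = 0` is exactly harmonic. -/
theorem IsOscillation.freqSq_lt_four (h : AreTurningPoints lam B P a b)
    (ho : IsOscillation (speedSq lam B P) (force lam B) a b τ X Y) (h1 : 1 < lam) (h2 : lam < 2)
    (hP : 0 < P) : (Real.pi / τ) ^ 2 < 4 := by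
  have hl : 0 < lam := by linarith
  refine ho.freqSq_lt h hl (α := 2 / lam) (by positivity) fun x hx => ?_
  have hx0 := h.pos.trans hx.1
  have e : coordFreqSq lam B P (2 / lam) x
      = 4 - 4 * P * (2 - lam) * (lam - 1) / (lam ^ 2 * x ^ 2) := by
    rw [coordFreqSq]; field_simp; ring
  rw [e]
  have : 0 < 4 * P * (2 - lam) * (lam - 1) / (lam ^ 2 * x ^ 2) := by
    have := sub_pos.2 h1
    have := sub_pos.2 h2
    positivity
  linarith

/-- The exponent `α = 2(1 + 1/λ)/3` is the one for which `H'''` vanishes at the equilibrium on the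
level of the equilibrium. For it `R_α - 2λ` is a positive multiple of `y² / x²`. -/
theorem IsOscillation.two_mul_lt_freqSq (h : AreTurningPoints lam B P a b)
    (ho : IsOscillation (speedSq lam B P) (force lam B) a b τ X Y) (h1 : 1 < lam) (h2 : lam < 2)
    (hB : 0 < B) : 2 * lam < (Real.pi / τ) ^ 2 := by
  have hl : 0 < lam := by linarith
  have hR : ∀ x ∈ Set.Ioo a b, 2 * lam < coordFreqSq lam B P (2 / 3 * (1 + 1 / lam)) x := by
    intro x hx
    have hx0 := h.pos.trans hx.1
    have hF := h.speedSq_pos h1 hB hx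
    have ht := Real.rpow_pos_of_pos hx0 (2 / lam)
    have e : coordFreqSq lam B P (2 / 3 * (1 + 1 / lam)) x
        = 2 * lam + 2 * (2 - lam) * (2 * lam - 1) / (9 * lam ^ 2) * (speedSq lam B P x / x ^ 2) := by
      rw [coordFreqSq, speedSq_eq B P hl.ne' hx0]; field_simp; ring
    rw [e]
    have h3 := sub_pos.2 h2
    have h4 : 0 < 2 * lam - 1 := by linarith
    have : 0 < 2 * (2 - lam) * (2 * lam - 1) / (9 * lam ^ 2) * (speedSq lam B P x / x ^ 2) := by
      positivity
    linarith
  exact ho.lt_freqSq h hl (by positivity) (fun _ _ x' hx' _ _ => hR x' hx') (Or.inr hR)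

theorem coordFreqSq_one (hlam : lam ≠ 0) (x : ℝ) :
    coordFreqSq lam B P 1 x
      = lam ^ 2 + B * (lam - 1) * (2 - lam) / lam ^ 2 / x ^ (2 / lam) := by
  rw [coordFreqSq]; field_simp; ring

/-- In the coordinate `x` itself the comparison function does not involve `P`. -/
theorem IsOscillation.freqSq_lt_of_lt (h : AreTurningPoints lam B P a b)
    (ho : IsOscillation (speedSq lam B P) (force lam B) a b τ X Y) (h1 : 1 < lam) (h2 : lam < 2)
    (hB : 0 < B) {x₀ : ℝ} (hx₀ : 0 < x₀) (hx₀a : x₀ < a) :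
    (Real.pi / τ) ^ 2
      < lam ^ 2 + B * (lam - 1) * (2 - lam) / lam ^ 2 / x₀ ^ (2 / lam) := by
  have hl : 0 < lam := by linarith
  refine ho.freqSq_lt h hl one_pos fun x hx => ?_
  rw [coordFreqSq_one hl.ne']
  have ht := Real.rpow_lt_rpow hx₀.le (hx₀a.trans hx.1) (show 0 < 2 / lam by positivity)
  have ht0 := Real.rpow_pos_of_pos hx₀ (2 / lam)
  have h3 := sub_pos.2 h1
  have h4 := sub_pos.2 h2
  have : 0 < B * (lam - 1) * (2 - lam) / lam ^ 2 := by positivity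
  gcongr

/-- For `1 < α < 2/λ` the function `R_α - κ` changes sign at most once, from negative to positive,
and the acceleration of `z` at the left turning point grows without bound as this point tends
to `0`. -/
theorem IsOscillation.lt_freqSq_of_left_small (h : AreTurningPoints lam B P a b)
    (ho : IsOscillation (speedSq lam B P) (force lam B) a b τ X Y) (h1 : 1 < lam) (h2 : lam < 2)
    (hP : 0 < P) {κ : ℝ} (hα1 : 1 < α) (hα2 : α < 2 / lam) (hκ0 : 0 < κ)
    (hκ : κ < lam ^ 2 * α ^ 2)
    (ha : κ * ((B / lam ^ 2) ^ (lam / 2)) ^ α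
      < 2 * α * (a ^ α * ((lam - 1) / lam * B / a ^ (2 / lam) - lam ^ 2))) :
    κ < (Real.pi / τ) ^ 2 := by
  have hl : 0 < lam := by linarith
  have hα : 0 < α := by linarith
  refine ho.lt_freqSq h hl hα ?_ (Or.inl ?_)
  · intro x hx x' hx' hlt hR
    have hx0 := h.pos.trans hx.1
    have hx0' := h.pos.trans hx'.1
    have hA : 0 < 2 * P * ((α - 1) * (2 - α)) := by
      have : 2 / lam < 2 := by rw [div_lt_iff₀ hl]; linarith
      have h3 := sub_pos.2 hα1
      have h4 : 0 < 2 - α := by linarith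
      positivity
    have hc := sub_pos.2 hκ
    -- multiplied by `x ^ (2 / λ)`, the difference `R_α - κ` is an increasing function
    have e : ∀ x : ℝ, 0 < x → (coordFreqSq lam B P α x - κ) * x ^ (2 / lam)
        = -(2 * P * ((α - 1) * (2 - α))) / x ^ ((2 * lam - 2) / lam)
          - B * ((α - 1 / lam) * (α - 2 / lam)) + (lam ^ 2 * α ^ 2 - κ) * x ^ (2 / lam) := by
      intro x hx
      have ht := Real.rpow_pos_of_pos hx (2 / lam)
      rw [coordFreqSq, rpow_speed_exponent hl.ne' hx]
      field_simp
      ring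
    have ht := Real.rpow_pos_of_pos hx0 (2 / lam)
    have ht' := Real.rpow_pos_of_pos hx0' (2 / lam)
    have hs := Real.rpow_pos_of_pos hx0 ((2 * lam - 2) / lam)
    have m1 := Real.rpow_lt_rpow hx0.le hlt (show 0 < 2 / lam by positivity)
    have m2 := Real.rpow_lt_rpow hx0.le hlt
      (show 0 < (2 * lam - 2) / lam from div_pos (by linarith) hl)
    have hpos := mul_pos (sub_pos.2 hR) ht
    rw [e x hx0] at hpos
    have m3 := div_lt_div_of_pos_left hA hs m2
    have m4 := mul_lt_mul_of_pos_left m1 hc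
    have hpos' : 0 < (coordFreqSq lam B P α x' - κ) * x' ^ (2 / lam) := by
      rw [e x' hx0', neg_div]
      rw [neg_div] at hpos
      linarith
    exact sub_pos.1 ((mul_pos_iff_of_pos_right ht').1 hpos')
  · refine lt_of_le_of_lt ?_ ha
    have hb : b ^ α ≤ ((B / lam ^ 2) ^ (lam / 2)) ^ α :=
      Real.rpow_le_rpow (h.pos.trans h.lt).le h.right_lt.le hα.le
    have ha0 := Real.rpow_pos_of_pos h.pos α
    gcongr
    linarith

end

theorem two_mul_lt_two_pi_div_sqrt_iff {κ τ : ℝ} (hκ : 0 < κ) (hτ : 0 < τ) :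
    2 * τ < 2 * Real.pi / √κ ↔ κ < (Real.pi / τ) ^ 2 := by
  rw [← Real.sqrt_lt' (div_pos Real.pi_pos hτ), lt_div_iff₀ (Real.sqrt_pos.2 hκ), lt_div_iff₀ hτ]
  constructor <;> intro h <;> linarith

theorem two_pi_div_sqrt_lt_two_mul_iff {κ τ : ℝ} (hκ : 0 < κ) (hτ : 0 < τ) :
    2 * Real.pi / √κ < 2 * τ ↔ (Real.pi / τ) ^ 2 < κ := by
  rw [← Real.lt_sqrt (div_pos Real.pi_pos hτ).le, div_lt_iff₀ (Real.sqrt_pos.2 hκ),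
    div_lt_iff₀ hτ]
  constructor <;> intro h <;> linarith

section

variable {lam B P a b τ : ℝ} {X Y : ℝ → ℝ}

theorem IsOscillation.pi_lt_period (h : AreTurningPoints lam B P a b)
    (ho : IsOscillation (speedSq lam B P) (force lam B) a b τ X Y) (h1 : 1 < lam) (h2 : lam < 2)
    (hP : 0 < P) : Real.pi < 2 * τ := by
  have := (two_pi_div_sqrt_lt_two_mul_iff (by norm_num) ho.half_pos).2
    (ho.freqSq_lt_four h h1 h2 hP)
  rw [show (4 : ℝ) = 2 ^ 2 by norm_num, Real.sqrt_sq (by norm_num)] at this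
  linarith

theorem IsOscillation.period_lt (h : AreTurningPoints lam B P a b)
    (ho : IsOscillation (speedSq lam B P) (force lam B) a b τ X Y) (h1 : 1 < lam) (h2 : lam < 2)
    (hB : 0 < B) : 2 * τ < 2 * Real.pi / √(2 * lam) :=
  (two_mul_lt_two_pi_div_sqrt_iff (by linarith) ho.half_pos).2 (ho.two_mul_lt_freqSq h h1 h2 hB)

theorem maxPressure_pos (h1 : 1 < lam) (hB : 0 < B) : 0 < maxPressure lam B := by
  have hl1 : 0 < lam - 1 := sub_pos.2 h1
  unfold maxPressure
  positivity

theorem periodFunction_mem_Ioo (h1 : 1 < lam) (h2 : lam < 2) (hB : 0 < B) (hP : 0 < P)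
    (hPm : P < maxPressure lam B) :
    periodFunction lam B P ∈ Set.Ioo Real.pi (2 * Real.pi / √(2 * lam)) := by
  obtain ⟨a, b, h⟩ := exists_turningPoints h1 hB hP hPm
  obtain ⟨τ, X, Y, ho⟩ := h.exists_isOscillation h1 hB
  rw [periodFunction_eq_of_isOscillation h1 hB h ho]
  exact ⟨ho.pi_lt_period h h1 h2 hP, ho.period_lt h h1 h2 hB⟩

/-! ### The limits of the period function -/

theorem AreTurningPoints.left_lt_of_lt (h : AreTurningPoints lam B P a b) (h1 : 1 < lam)
    (hB : 0 < B) {x : ℝ} (hx : 0 < x) (hP : 2 * P < speedSq lam B 0 x) : a < x := by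
  by_contra hcon
  rw [not_lt] at hcon
  have hF : speedSq lam B P x = speedSq lam B 0 x - 2 * P := by rw [speedSq, speedSq]; ring
  rcases hcon.lt_or_eq with hlt | heq
  · have := speedSq_lt_of_le_equilibrium h1 hB P hx hlt h.left_lt.le
    rw [h.speedSq_left] at this
    linarith
  · rw [heq, h.speedSq_left] at hF
    rw [heq] at hP
    linarith

theorem AreTurningPoints.lt_left_of_lt (h : AreTurningPoints lam B P a b) (h1 : 1 < lam)
    (hB : 0 < B) {x : ℝ} (hx : x ≤ equilibrium lam B) (hP : speedSq lam B 0 x < 2 * P) :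
    x < a := by
  by_contra hcon
  rw [not_lt] at hcon
  have hF : speedSq lam B P x = speedSq lam B 0 x - 2 * P := by rw [speedSq, speedSq]; ring
  rcases hcon.lt_or_eq with hlt | heq
  · have := speedSq_lt_of_le_equilibrium h1 hB P h.pos hlt hx
    rw [h.speedSq_left] at this
    linarith
  · rw [← heq, h.speedSq_left] at hF
    rw [← heq] at hP
    linarith

theorem tendsto_left_acceleration {α : ℝ} (h1 : 1 < lam) (hB : 0 < B) (hα0 : 0 < α)
    (hα : α < 2 / lam) :
    Tendsto (fun x : ℝ => 2 * α * (x ^ α * ((lam - 1) / lam * B / x ^ (2 / lam) - lam ^ 2)))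
      (𝓝[>] 0) atTop := by
  have hl : 0 < lam := by linarith
  have t1 := tendsto_rpow_neg_nhdsGT_zero (sub_neg.2 hα)
  have t2 : Tendsto (fun x : ℝ => x ^ α) (𝓝[>] 0) (𝓝 0) := by
    have := (Real.continuous_rpow_const hα0.le).tendsto 0
    rw [Real.zero_rpow hα0.ne'] at this
    exact this.mono_left nhdsWithin_le_nhds
  have hc : 0 < (lam - 1) / lam * B := by
    have := sub_pos.2 h1
    positivity
  have t3 := ((t1.const_mul_atTop hc).atTop_add (t2.const_mul (-lam ^ 2))).const_mul_atTop
    (show 0 < 2 * α by positivity)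
  refine t3.congr' ?_
  filter_upwards [self_mem_nhdsWithin] with x hx
  have hx0 : 0 < x := hx
  have ht := Real.rpow_pos_of_pos hx0 (2 / lam)
  rw [Real.rpow_sub hx0]
  field_simp
  ring

theorem tendsto_periodFunction_zero (h1 : 1 < lam) (h2 : lam < 2) (hB : 0 < B) :
    Tendsto (periodFunction lam B) (𝓝[>] 0) (𝓝 Real.pi) := by
  have hl : 0 < lam := by linarith
  have hI := Ioo_mem_nhdsGT (maxPressure_pos h1 hB)
  refine tendsto_order.2 ⟨fun c hc => ?_, fun c hc => ?_⟩
  · filter_upwards [hI] with P hP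
    exact hc.trans (periodFunction_mem_Ioo h1 h2 hB hP.1 hP.2).1
  · have hpi := Real.pi_pos
    have hc0 : 0 < c := hpi.trans hc
    -- a frequency `s < 2` whose period is still below `c`
    obtain ⟨s, hs1, hs2⟩ := exists_between (show 2 * Real.pi / c < 2 by
      rw [div_lt_iff₀ hc0]; linarith)
    have hs0 : 0 < s := lt_trans (by positivity) hs1
    obtain ⟨α, hα1, hα2⟩ := exists_between (show max 1 (s / lam) < 2 / lam from
      max_lt (by rw [lt_div_iff₀ hl]; linarith) (by gcongr))
    have hα1' : 1 < α := (le_max_left _ _).trans_lt hα1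
    have hκ : s ^ 2 < lam ^ 2 * α ^ 2 := by
      have h3 := (le_max_right _ _).trans_lt hα1
      rw [div_lt_iff₀ hl] at h3
      rw [← mul_pow]
      gcongr
      linarith
    have hev := (tendsto_left_acceleration (α := α) h1 hB (by linarith) hα2).eventually_gt_atTop
      (s ^ 2 * ((B / lam ^ 2) ^ (lam / 2)) ^ α)
    obtain ⟨δ, hδ, hsub⟩ := mem_nhdsGT_iff_exists_Ioo_subset.1 hev
    have hδ0 : 0 < δ := hδ
    have he := equilibrium_pos h1 hB
    have hm : 0 < min δ (equilibrium lam B) := lt_min hδ0 he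
    have hF := speedSq_zero_pos h1 hB hm (min_le_right _ _)
    filter_upwards [hI, Ioo_mem_nhdsGT (half_pos hF)] with P hP hP'
    obtain ⟨a, b, h⟩ := exists_turningPoints h1 hB hP.1 hP.2
    obtain ⟨τ, X, Y, ho⟩ := h.exists_isOscillation h1 hB
    rw [periodFunction_eq_of_isOscillation h1 hB h ho]
    have ha := h.left_lt_of_lt h1 hB hm (by linarith [hP'.2])
    have hlt := ho.lt_freqSq_of_left_small h h1 h2 hP.1 hα1' hα2 (by positivity) hκ
      (hsub ⟨h.pos, ha.trans_le (min_le_left _ _)⟩)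
    have hT := (two_mul_lt_two_pi_div_sqrt_iff (by positivity) ho.half_pos).2 hlt
    rw [Real.sqrt_sq hs0.le] at hT
    refine hT.trans ?_
    rw [div_lt_iff₀ hs0]
    rw [div_lt_iff₀ hc0] at hs1
    linarith

theorem tendsto_periodFunction_maxPressure (h1 : 1 < lam) (h2 : lam < 2) (hB : 0 < B) :
    Tendsto (periodFunction lam B) (𝓝[<] (maxPressure lam B))
      (𝓝 (2 * Real.pi / √(2 * lam))) := by
  have hl : 0 < lam := by linarith
  have hI := Ioo_mem_nhdsLT (maxPressure_pos h1 hB)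
  refine tendsto_order.2 ⟨fun c hc => ?_, fun c hc => ?_⟩
  · have he := equilibrium_pos h1 hB
    set κ : ℝ → ℝ := fun x => lam ^ 2 + B * (lam - 1) * (2 - lam) / lam ^ 2 / x ^ (2 / lam) with hκ
    have h3 := sub_pos.2 h1
    have h4 := sub_pos.2 h2
    have hκ0 : ∀ x, 0 < x → 0 < κ x := fun x hx => by
      have := Real.rpow_pos_of_pos hx (2 / lam)
      simp only [hκ]
      positivity
    have hκe : κ (equilibrium lam B) = 2 * lam := by
      simp only [hκ, equilibrium_rpow h1 hB]
      field_simp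
      ring
    have hcont : ContinuousAt (fun x => 2 * Real.pi / √(κ x)) (equilibrium lam B) := by
      have hp : ContinuousAt (fun x : ℝ => x ^ (2 / lam)) (equilibrium lam B) :=
        Real.continuousAt_rpow_const _ _ (Or.inl he.ne')
      have hk : ContinuousAt κ (equilibrium lam B) :=
        continuousAt_const.add (continuousAt_const.div hp (Real.rpow_pos_of_pos he _).ne')
      exact continuousAt_const.div hk.sqrt (Real.sqrt_pos.2 (hκ0 _ he)).ne'
    have hev : ∀ᶠ x in 𝓝[<] equilibrium lam B, c < 2 * Real.pi / √(κ x) := by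
      refine (hcont.eventually (lt_mem_nhds ?_)).filter_mono nhdsWithin_le_nhds
      simpa only [hκe] using hc
    obtain ⟨x₀, hx₀, hx₀0, hx₀e⟩ := (hev.and (Ioo_mem_nhdsLT he)).exists
    have hF : speedSq lam B 0 x₀ / 2 < maxPressure lam B := by
      have := speedSq_lt_of_le_equilibrium h1 hB 0 hx₀0 hx₀e le_rfl
      rw [speedSq_equilibrium h1 hB] at this
      linarith
    filter_upwards [hI, Ioo_mem_nhdsLT hF] with P hP hP'
    obtain ⟨a, b, h⟩ := exists_turningPoints h1 hB hP.1 hP.2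
    obtain ⟨τ, X, Y, ho⟩ := h.exists_isOscillation h1 hB
    rw [periodFunction_eq_of_isOscillation h1 hB h ho]
    have ha := h.lt_left_of_lt h1 hB hx₀e.le (by linarith [hP'.1])
    exact hx₀.trans ((two_pi_div_sqrt_lt_two_mul_iff (hκ0 x₀ hx₀0) ho.half_pos).2
      (ho.freqSq_lt_of_lt h h1 h2 hB hx₀0 ha))
  · filter_upwards [hI] with P hP
    exact (periodFunction_mem_Ioo h1 h2 hB hP.1 hP.2).2.trans hc

/-! ### Nonexistence of periodic solutions -/

theorem IsPositiveSolution.periodic_snd {x y : ℝ → ℝ} (h : IsPositiveSolution lam B P x y) {S : ℝ}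
    (hp : Function.Periodic x S) : Function.Periodic y S := fun θ => by
  have h1 := (h.hasDerivAt_fst (θ + S)).comp_add_const θ S
  simp only [hp _] at h1
  exact h1.unique (h.hasDerivAt_fst θ)

/-- Since `y` is periodic, the force cannot be negative throughout. A point where it is not forces
`B > 0` and, compared with a minimum of `x`, also `P > 0`. At or above `maxPressure` only the
equilibrium is left. -/
theorem IsPositiveSolution.level_mem {x y : ℝ → ℝ} (h : IsPositiveSolution lam B P x y)
    (h1 : 1 < lam) {S : ℝ} (hS : 0 < S) (hp : Function.Periodic x S) {θ₁ θ₂ : ℝ}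
    (hne : x θ₁ ≠ x θ₂) : 0 < B ∧ 0 < P ∧ P < maxPressure lam B := by
  have hl : 0 < lam := by linarith
  have hx : Continuous x := continuous_iff_continuousAt.2 fun t => (h.hasDerivAt_fst t).continuousAt
  have hforce : ∃ θ, 0 ≤ force lam B (x θ) := by
    by_contra hcon
    push Not at hcon
    have hanti := strictAnti_of_hasDerivAt_neg h.hasDerivAt_snd hcon
    have := hanti hS
    rw [← h.periodic_snd hp 0, zero_add] at this
    exact lt_irrefl _ this
  obtain ⟨_, ⟨θm, rfl⟩, hmin⟩ := (hp.compact_of_continuous hS.ne' hx).exists_isLeast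
    (Set.range_nonempty x)
  have hmin' : ∀ θ, x θm ≤ x θ := fun θ => hmin ⟨θ, rfl⟩
  have hym : y θm = 0 :=
    IsLocalMin.hasDerivAt_eq_zero (Eventually.of_forall hmin') (h.hasDerivAt_fst θm)
  obtain ⟨θ, hθ⟩ := hforce
  have hxθ := h.pos θ
  have ht := Real.rpow_pos_of_pos hxθ (2 / lam)
  have hxm := h.pos θm
  have htm := Real.rpow_pos_of_pos hxm (2 / lam)
  rw [force_eq B hl.ne' hxθ] at hθ
  have hθ1 : lam ^ 2 ≤ (lam - 1) / lam * B / x θ ^ (2 / lam) :=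
    sub_nonneg.1 (nonneg_of_mul_nonneg_right hθ hxθ)
  have hB : 0 < B := by
    rw [le_div_iff₀ ht] at hθ1
    have h3 : 0 < (lam - 1) / lam := div_pos (sub_pos.2 h1) hl
    have h4 : 0 < lam ^ 2 * x θ ^ (2 / lam) := by positivity
    exact (mul_pos_iff_of_pos_left h3).1 (h4.trans_le hθ1)
  refine ⟨hB, ?_, ?_⟩
  · -- `2P = F₀(x)` at the minimum, and `λ² x ^ (2 / λ) < B` there
    have hE := h.energy θm
    rw [hym, speedSq_eq B P hl.ne' hxm] at hE
    have hlt : lam ^ 2 < B / x θm ^ (2 / lam) := by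
      have h3 : (lam - 1) / lam * B / x θ ^ (2 / lam) < B / x θ ^ (2 / lam) := by
        rw [div_lt_div_iff_of_pos_right ht, div_mul_eq_mul_div, div_lt_iff₀ hl]
        linarith
      have h4 : B / x θ ^ (2 / lam) ≤ B / x θm ^ (2 / lam) := by
        have := Real.rpow_le_rpow hxm.le (hmin' θ) (show 0 ≤ 2 / lam by positivity)
        gcongr
      linarith
    have := mul_pos (pow_pos hxm 2) (sub_pos.2 hlt)
    linarith
  · by_contra hcon
    rw [not_lt] at hcon
    have he : ∀ t, x t = equilibrium lam B := fun t => by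
      have hE := h.energy t
      have hF : 0 ≤ speedSq lam B P (x t) := hE ▸ sq_nonneg _
      have hFe : speedSq lam B P (equilibrium lam B) ≤ 0 := by
        rw [speedSq_equilibrium h1 hB]; linarith
      rcases lt_trichotomy (x t) (equilibrium lam B) with hlt | heq | hgt
      · have := speedSq_lt_of_le_equilibrium h1 hB P (h.pos t) hlt le_rfl
        linarith
      · exact heq
      · have := speedSq_lt_of_equilibrium_le h1 hB P le_rfl hgt
        linarith
    exact hne (by rw [he, he])

/-- No multiple of a period in `(π, 2π/√(2λ))` lies in `[2π/√(2λ), 2π]`. -/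
theorem IsEllipticAtLevel.not_periodic {x : ℝ → ℝ} (hx : IsEllipticAtLevel lam B P x)
    (h1 : 1 < lam) (h2 : lam < 2) {θ₁ θ₂ : ℝ} (hne : x θ₁ ≠ x θ₂) {S : ℝ}
    (hS : 2 * Real.pi / √(2 * lam) ≤ S) (hS' : S ≤ 2 * Real.pi) : ¬ Function.Periodic x S := by
  have key : ∀ x : ℝ → ℝ, IsEllipticAtLevel lam B P x → (∀ θ, 0 < x θ) → x θ₁ ≠ x θ₂ →
      ¬ Function.Periodic x S := by
    intro x hx hpos hne hp
    have hS0 : 0 < S := by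
      refine lt_of_lt_of_le (div_pos Real.two_pi_pos (Real.sqrt_pos.2 ?_)) hS
      linarith
    obtain ⟨y, hy⟩ := (isEllipticAtLevel_iff_of_pos hpos).1 hx
    obtain ⟨hB, hP, hPm⟩ := hy.level_mem h1 hS0 hp hne
    obtain ⟨a, b, h⟩ := exists_turningPoints h1 hB hP hPm
    obtain ⟨τ, X, Y, ho⟩ := h.exists_isOscillation h1 hB
    have hT1 := ho.pi_lt_period h h1 h2 hP
    have hT2 := ho.period_lt h h1 h2 hB
    exact ho.not_periodic hS0 (by linarith) (by linarith)
      ((periodic_iff_of_isOscillation h1 hB h ho hx S).1 hp)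
  rcases hx.pos_or_neg with hpos | hpos
  · exact key x hx hpos hne
  · exact fun hp => key _ hx.neg hpos (fun e => hne (neg_injective e))
      (fun θ => congrArg Neg.neg (hp θ))

theorem not_two_pi_periodic_of_one_lt (h1 : 1 < lam) (h2 : lam < 2) {x y : ℝ → ℝ}
    (h : IsEllipticSolution lam B x y) {θ₁ θ₂ : ℝ} (hne : x θ₁ ≠ x θ₂) :
    ¬ Function.Periodic x (2 * Real.pi) := by
  obtain ⟨P, hP⟩ := h.exists_level (by linarith)
  refine hP.not_periodic h1 h2 hne ?_ le_rfl
  refine div_le_self Real.two_pi_pos.le ?_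
  rw [Real.one_le_sqrt]
  linarith

/-- With `μ = 1/λ`, the conjugate solution has the period `2π/μ`, which is at least `2π/√(2μ)`
because `μ ≤ 2`. -/
theorem not_two_pi_periodic_of_lt_one (h1 : 1 / 2 < lam) (h2 : lam < 1) {x y : ℝ → ℝ}
    (h : IsEllipticSolution lam B x y) {θ₁ θ₂ : ℝ} (hne : x θ₁ ≠ x θ₂) :
    ¬ Function.Periodic x (2 * Real.pi) := by
  have hl : 0 < lam := by linarith
  intro hp
  obtain ⟨P, hP⟩ := h.exists_level hl.ne'
  have hμ1 : 1 < 1 / lam := (one_lt_div hl).2 h2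
  have hμ2 : 1 / lam < 2 := by rw [div_lt_iff₀ hl]; linarith
  have hpi := Real.pi_pos
  refine (hP.conjugate hl).not_periodic (θ₁ := θ₁ * lam) (θ₂ := θ₂ * lam) (S := 2 * Real.pi * lam)
    hμ1 hμ2 ?_ ?_ ?_ ?_
  · intro e
    simp only [conjugate, mul_div_cancel_right₀ _ hl.ne'] at e
    have hα : 1 / lam ≠ 0 := (one_div_pos.2 hl).ne'
    have e' := congrArg (fun z => signedPow z (1 / (1 / lam))) e
    simp only [signedPow_inverse hα (h.ne_zero _)] at e'
    exact hne e'
  · have hs : 1 / lam ≤ √(2 * (1 / lam)) := by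
      refine Real.le_sqrt_of_sq_le ?_
      nlinarith
    calc 2 * Real.pi / √(2 * (1 / lam)) ≤ 2 * Real.pi / (1 / lam) := by gcongr
      _ = 2 * Real.pi * lam := by field_simp
  · nlinarith
  · intro θ
    simp only [conjugate]
    rw [show (θ + 2 * Real.pi * lam) / lam = θ / lam + 2 * Real.pi by field_simp, hp]

end

end

theorem mainTheorem2 :
    -- the period function lies strictly between its boundary values
    (∀ lam B : ℝ, 1 < lam → lam < 2 → 0 < B →
      (∀ P : ℝ, 0 < P → P < maxPressure lam B →
        (∃ x : ℝ → ℝ, IsEllipticAtLevel lam B P x) ∧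
        (∀ x : ℝ → ℝ, IsEllipticAtLevel lam B P x →
          IsLeast {T : ℝ | 0 < T ∧ Function.Periodic x T} (periodFunction lam B P)) ∧
        Real.pi < periodFunction lam B P ∧
        periodFunction lam B P < 2 * Real.pi / Real.sqrt (2 * lam)) ∧
      Tendsto (periodFunction lam B) (𝓝[>] 0) (𝓝 Real.pi) ∧
      Tendsto (periodFunction lam B) (𝓝[<] (maxPressure lam B))
        (𝓝 (2 * Real.pi / Real.sqrt (2 * lam)))) ∧
    -- no nonconstant `2π`-periodic elliptic solutions for `1 < λ < 2` (so for `1 < λ < 4/3`)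
    (∀ lam B : ℝ, 1 < lam → lam < 2 →
      ¬ ∃ x y : ℝ → ℝ, IsEllipticSolution lam B x y ∧
        Function.Periodic x (2 * Real.pi) ∧ ∃ θ₁ θ₂ : ℝ, x θ₁ ≠ x θ₂) ∧
    -- the conjugacy between the systems with parameters `λ` and `1/λ`
    (∀ lam B P : ℝ, 0 < lam → ∀ x : ℝ → ℝ,
      IsEllipticAtLevel lam B P x ↔
        IsEllipticAtLevel (1 / lam) (-2 * P / lam ^ 4) (-B / (2 * lam ^ 4)) (conjugate lam x)) ∧
    -- no nonconstant `2π`-periodic elliptic solutions for `3/4 < λ < 1`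
    (∀ lam B : ℝ, 3 / 4 < lam → lam < 1 →
      ¬ ∃ x y : ℝ → ℝ, IsEllipticSolution lam B x y ∧
        Function.Periodic x (2 * Real.pi) ∧ ∃ θ₁ θ₂ : ℝ, x θ₁ ≠ x θ₂) := by
  refine ⟨fun lam B h1 h2 hB => ⟨fun P hP hPm => ?_, tendsto_periodFunction_zero h1 h2 hB,
    tendsto_periodFunction_maxPressure h1 h2 hB⟩, ?_,
    fun lam B P hl x => isEllipticAtLevel_conjugate_iff hl x, ?_⟩
  · obtain ⟨a, b, h⟩ := exists_turningPoints h1 hB hP hPm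
    obtain ⟨τ, X, Y, ho⟩ := h.exists_isOscillation h1 hB
    refine ⟨⟨X, ho.isEllipticAtLevel h⟩, fun x hx => ?_, periodFunction_mem_Ioo h1 h2 hB hP hPm⟩
    rw [periodFunction_eq_of_isOscillation h1 hB h ho]
    exact isLeast_period_of_isOscillation h1 hB h ho hx
  · rintro lam B h1 h2 ⟨x, y, h, hp, θ₁, θ₂, hne⟩
    exact not_two_pi_periodic_of_one_lt h1 h2 h hne hp
  · rintro lam B h1 h2 ⟨x, y, h, hp, θ₁, θ₂, hne⟩
    exact not_two_pi_periodic_of_lt_one (by linarith) h2 h hne hp
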